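/- **Setting.** Let $T>0$ and let $X=(X_t)_{t\in[0,T]}$ be a continuous centered Gaussian process with $X_0=0$ and covariance $R(t,s)=\mathbb E[X_tX_s]$. Assume that $X$ is a *regular invertible Gaussian Volterra process*: there are a continuous increasing $m\colon[0,T]\to\mathbb R_+$ and a kernel $K$ with $K(t,s)=0$ for $t<s$, with $K\in L^2([0,T]^2,dm\times dm)$ and $K(t,\cdot)\in L^2([0,T],dm)$ for every $t$, non-decreasing in $t$, for which $\partial K/\partial t$ exists and is continuous on $\{0<s<t\le T\}$ and $s\mapsto K(s,s)$ is continuously differentiable on $(0,T]$, such that $$R(t,s)=\int_0^{t\wedge s}K(t,v)K(s,v)\,dm(v),$$ and such that, with $$\mathrm K^*[f](s)=f(s)K(T,s)+\int_s^T\big[f(t)-f(s)\big]\frac{\partial K}{\partial t}(t,s)\,dt,$$ the equation $\mathrm K^*[f]=1_{[0,t)}$ has, for every $t\in[0,T]$, a solution $f$ in $\Lambda_t$. Here $\Lambda_u$ is the completion of the space of step functions on $[0,u]$ (linear combinations of the $1_{[0,r)}$, $r\le u$) in the norm $\|f\|^2=\int_0^T \mathrm K^*[f]^2\,dm$, and $\mathrm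 K^*$ is extended to $\Lambda_u$ by continuity, as an isometry into $L^2([0,T],dm)$. The Wiener integral $\int_0^u f\,dX$, $f\in\Lambda_u$, is the $L^2(\mathbb P)$-continuous extension of $1_{[0,r)}\mapsto X_r$. Let $q^2(t)$ be the (deterministic) quadratic variation of $X$ on $[0,t]$, i.e. the limit in probability of $\sum_{t_k\le t}(X_{t_k}-X_{t_{k-1}})^2$ along sequences of partitions of $[0,T]$ with mesh tending to $0$; put $q^2(s,t)=q^2(t)-q^2(s)$ and $q(s,t)=\sqrt{q^2(s,t)}$. Let $\mu\colon[0,T]\to\mathbb R$ be continuous and of bounded variation, $S_0>0$, and let $$S_t=S_0\exp\{\mu(t)-\mu(0)-\tfrac12q^2(t)+X_t\}$$ be the asset price, with $\mathcal F_t=\sigma(S_s,\,s\le t)$. Denote $$\beta(s,t)=\mu(t)-\mu(s)-\tfrac12q^2(s,t),\qquad \gamma(s,t,T)=\beta(s,t)-\tfrac12q^2(t,T),$$ $$\hat\rho^2(t|u)=R(t,t)-\int_0^uK(t,v)^2\,dm(v),\ \hat\rho\ge0,\qquad \Psi(t,\cdot\,|u)=(\mathrm K^*)^{-1}\big[(K(u,\cdot)-K(t,\cdot))1_{[0,u)}\big]\in\Lambda_u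 ,$$ and let $\phi$ be the standard Gaussian density. Let $f$ be a measurable payoff function, and let $$V^\pi_t=v(t,S_t),\qquad v(t,x)=\int_{-\infty}^\infty f\big(xe^{-\frac12q^2(t,T)+q(t,T)z}\big)\phi(z)\,dz,$$ be the value process of the Markovian replicating strategy of the claim $f(S_T)$. Let $0=t_0<t_1<\dots<t_N<T$, let $\pi^N_{t_j}$ be $\mathcal F_{t_j}$-measurable for $j<N$, let $\pi^N_t=\pi^N_0 1_{\{0\}}(t)+\sum_{j=1}^N\pi^N_{t_{j-1}}1_{(t_{j-1},t_j]}(t)$ and $\Delta\pi^N_{t_j}=\pi^N_{t_j}-\pi^N_{t_{j-1}}$ for $j\ge1$, $\Delta\pi^N_{t_0}=\pi^N_0$. For $k\in[0,1)$ and $V_0\in\mathbb R$ the value of $\pi^N$ under proportional transaction costs is $$V^{\pi^N,k}_t=V_0+\int_0^t\pi^N_u\,dS_u-\int_0^tkS_u\,|d\pi^N_u| =V_0+\sum_{j<N}\pi^N_{t_j}\big(S_{t_{j+1}\wedge t}-S_{t_j\wedge t}\big)-\sum_{j<N:\,t_j<t}kS_{t_j}|\Delta\pi^N_{t_j}|,\quad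 t\le t_N.$$ For a process $Y$ write $\Delta\hat Y_{t_{i+1}}(t_i)=\mathbb E[Y_{t_{i+1}}\,|\,\mathcal F_{t_i}]-Y_{t_i}$. **Lemma 5.1 (Conditional gains).** Let $0\le i<N$. Then $X_{t_{i+1}}$ and $S_{t_{i+1}}$ are integrable, $\mathrm{Var}[X_{t_{i+1}}-X_{t_i}\,|\,\mathcal F_{t_i}]=\hat\rho^2(t_{i+1}|t_i)$, and almost surely $$\Delta\hat X_{t_{i+1}}(t_i)=-\int_0^{t_i}\Psi(t_{i+1},s|t_i)\,dX_s,$$ $$\Delta\hat S_{t_{i+1}}(t_i)=S_{t_i}\Big(e^{\beta(t_i,t_{i+1})+\frac12\hat\rho^2(t_{i+1}|t_i)+\Delta\hat X_{t_{i+1}}(t_i)}-1\Big).$$ If $z\mapsto f(S_{t_i}e^{-\frac12q^2(t_i,T)+q(t_i,T)z})$ is almost surely $\phi(z)dz$-integrable and $f(S_{t_{i+1}}e^{-\frac12q^2(t_{i+1},T)+q(t_{i+1},T)z})$ is $\mathbb P\otimes\phi(z)dz$-integrable, then $V^\pi_{t_{i+1}}$ is integrable and almost surely $$\Delta\hat V^\pi_{t_{i+1}}(t_i)=\int_{-\infty}^\infty\Big[\int_{-\infty}^\infty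 f\Big(S_{t_i}e^{\gamma(t_i,t_{i+1},T)+\Delta\hat X_{t_{i+1}}(t_i)+\hat\rho(t_{i+1}|t_i)y+q(t_{i+1},T)z}\Big)\phi(y)\,dy-f\Big(S_{t_i}e^{-\frac12q^2(t_i,T)+q(t_i,T)z}\Big)\Big]\phi(z)\,dz,$$ the first term being absolutely integrable for $\phi(y)\phi(z)\,dy\,dz$. If $V^{\pi^N,k}_{t_{i+1}}$ is integrable, then almost surely $$\Delta\hat V^{\pi^N,k}_{t_{i+1}}(t_i)=\pi^N_{t_i}\,\Delta\hat S_{t_{i+1}}(t_i)-kS_{t_i}|\Delta\pi^N_{t_i}|.$$ -/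

import Mathlib

open MeasureTheory ProbabilityTheory Filter Set
open scoped Topology ENNReal

noncomputable section

namespace GaussVolterra

/-! ### Step functions, the operator `K*` and the Wiener integral

A step function `∑ c_r 1_{[0,r)}` is given by its finitely supported coefficient family `c`. -/

/-- The step function `s ↦ ∑ c_r 1_{[0,r)}(s)`. -/
def stepFn (c : ℝ →₀ ℝ) (s : ℝ) : ℝ :=
  c.sum fun r a => a * (Ico 0 r).indicator (fun _ => (1 : ℝ)) s

/-- The integral `∑ c_r X_r` of the step function `∑ c_r 1_{[0,r)}` with respect to `X`
(where `X_0 = 0`). -/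
def stepInt {Ω : Type*} (X : ℝ → Ω → ℝ) (c : ℝ →₀ ℝ) (ω : Ω) : ℝ :=
  c.sum fun r a => a * X r ω

/-- `∂K/∂t (t, s)`, as a (one-sided at the end points) derivative on `[0,T]`. -/
def dK (T : ℝ) (K : ℝ → ℝ → ℝ) (t s : ℝ) : ℝ :=
  derivWithin (fun r => K r s) (Icc 0 T) t

/-- `K*[f](s) = f(s) K(T,s) + ∫_s^T (f(t) - f(s)) ∂K/∂t(t,s) dt`. -/
def kStar (T : ℝ) (K : ℝ → ℝ → ℝ) (f : ℝ → ℝ) (s : ℝ) : ℝ :=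
  f s * K T s + ∫ t in s..T, (f t - f s) * dK T K t s

/-- The space of Wiener integrands on `[0,u]` is the closure of the step functions on `[0,u]` for
the norm `‖f‖² = ∫_0^T K*[f]² dm`; an element is given by an approximating sequence `ψ` of step
functions. `SolvesKStar T m K u g ψ` says that `ψ` defines an element of this closure and that
`K*[ψ] = g`, where `K*` is extended to the closure by continuity, with values in `L²([0,T], dm)`. -/
def SolvesKStar (T : ℝ) (m : StieltjesFunction ℝ) (K : ℝ → ℝ → ℝ) (u : ℝ) (g : ℝ → ℝ)
    (ψ : ℕ → ℝ →₀ ℝ) : Prop :=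
  (∀ n, ∀ r ∈ (ψ n).support, r ∈ Icc 0 u) ∧
    Tendsto (fun n => eLpNorm (fun s => kStar T K (stepFn (ψ n)) s - g s) 2
      (m.measure.restrict (Icc 0 T))) atTop (𝓝 0)

open Classical in
/-- `(K*)⁻¹[g]` as a Wiener integrand on `[0,u]` (unique up to the identification of sequences at
distance `0`; the default value `0` is taken only if there is no solution). -/
def kStarInv (T : ℝ) (m : StieltjesFunction ℝ) (K : ℝ → ℝ → ℝ) (u : ℝ) (g : ℝ → ℝ) :
    ℕ → ℝ →₀ ℝ :=
  if h : ∃ ψ, SolvesKStar T m K u g ψ then h.choose else fun _ => 0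

/-- `I` is the `L²(P)`-limit of the integrals of the step functions `ψ n`. -/
def HasWienerInt {Ω : Type*} [MeasurableSpace Ω] (P : Measure Ω) (X : ℝ → Ω → ℝ)
    (ψ : ℕ → ℝ →₀ ℝ) (I : Ω → ℝ) : Prop :=
  MemLp I 2 P ∧ Tendsto (fun n => eLpNorm (fun ω => stepInt X (ψ n) ω - I ω) 2 P) atTop (𝓝 0)

open Classical in
/-- The Wiener integral with respect to `X`: the continuous extension of `stepInt` to the closure
of the step functions (unique up to `P`-null sets). -/
def wienerInt {Ω : Type*} [MeasurableSpace Ω] (P : Measure Ω) (X : ℝ → Ω → ℝ)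
    (ψ : ℕ → ℝ →₀ ℝ) : Ω → ℝ :=
  if h : ∃ I, HasWienerInt P X ψ I then h.choose else fun _ => 0

/-! ### Quadratic variation -/

/-- `0 = τ n 0 < τ n 1 < ⋯ < τ n (M n) = T` is a sequence of partitions of `[0,T]` whose mesh tends
to zero. -/
def IsPartitionSeq (T : ℝ) (M : ℕ → ℕ) (τ : ℕ → ℕ → ℝ) : Prop :=
  (∀ n, τ n 0 = 0 ∧ τ n (M n) = T ∧ ∀ j < M n, τ n j < τ n (j + 1)) ∧
    ∀ ε > 0, ∀ᶠ n in atTop, ∀ j < M n, τ n (j + 1) - τ n j < ε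

/-- The quadratic variation of `X` at time `t` is the constant `c`: the sums of squared increments
converge to `c` in probability along every sequence of partitions with mesh tending to zero. -/
def HasQuadVar {Ω : Type*} [MeasurableSpace Ω] (P : Measure Ω) (X : ℝ → Ω → ℝ) (T t c : ℝ) : Prop :=
  ∀ (M : ℕ → ℕ) (τ : ℕ → ℕ → ℝ), IsPartitionSeq T M τ →
    TendstoInMeasure P
      (fun n ω => ∑ j ∈ (Finset.range (M n)).filter (fun j => τ n (j + 1) ≤ t),
        (X (τ n (j + 1)) ω - X (τ n j) ω) ^ 2)
      atTop (fun _ => c)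

open Classical in
/-- The (deterministic) quadratic variation `q²(t) = ⟨X⟩_t`. -/
def quadVar {Ω : Type*} [MeasurableSpace Ω] (P : Measure Ω) (X : ℝ → Ω → ℝ) (T t : ℝ) : ℝ :=
  if h : ∃ c, HasQuadVar P X T t c then h.choose else 0

/-! ### Regular invertible Gaussian Volterra processes -/

/-- Regular Volterra kernels with respect to the continuous increasing function `m`. -/
structure IsRegularKernel (T : ℝ) (m : StieltjesFunction ℝ) (K : ℝ → ℝ → ℝ) : Prop where
  m_continuous : Continuous m
  m_nonneg : ∀ t ∈ Icc 0 T, 0 ≤ m t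
  volterra : ∀ t s, t < s → K t s = 0
  memLp_prod : MemLp (fun p : ℝ × ℝ => K p.1 p.2) 2
    ((m.measure.restrict (Icc 0 T)).prod (m.measure.restrict (Icc 0 T)))
  /-- needed for the covariance representation to make sense -/
  memLp_section : ∀ t ∈ Icc 0 T, MemLp (fun s => K t s) 2 (m.measure.restrict (Icc 0 T))
  monotone : ∀ s ∈ Icc 0 T, MonotoneOn (fun t => K t s) (Icc 0 T)
  /-- partial continuous differentiability outside the diagonal -/
  differentiable : ∀ s, 0 < s → DifferentiableOn ℝ (fun t => K t s) (Ioc s T)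
  continuous_dK : ContinuousOn (fun p : ℝ × ℝ => dK T K p.1 p.2)
    {p | 0 < p.2 ∧ p.2 < p.1 ∧ p.1 ≤ T}
  /-- continuous differentiability on the diagonal -/
  diagonal : ContDiffOn ℝ 1 (fun s => K s s) (Ioc 0 T)

/-- `X` is a continuous centered Gaussian process on `[0,T]` with `X_0 = 0`, and it is a regular
invertible Gaussian Volterra process with the function `m` and the kernel `K`. -/
structure IsRIGVolterra {Ω : Type*} [MeasurableSpace Ω] (P : Measure Ω) (X : ℝ → Ω → ℝ)
    (T : ℝ) (m : StieltjesFunction ℝ) (K : ℝ → ℝ → ℝ) : Prop where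
  measurable : ∀ t ∈ Icc 0 T, Measurable (X t)
  gaussian : IsGaussianProcess (fun t : Icc (0 : ℝ) T => X t) P
  centered : ∀ t ∈ Icc 0 T, ∫ ω, X t ω ∂P = 0
  continuous_paths : ∀ᵐ ω ∂P, ContinuousOn (fun t => X t ω) (Icc 0 T)
  initial : ∀ᵐ ω ∂P, X 0 ω = 0
  kernel : IsRegularKernel T m K
  covariance : ∀ t ∈ Icc 0 T, ∀ s ∈ Icc 0 T,
    ∫ ω, X t ω * X s ω ∂P = ∫ v in (0 : ℝ)..min t s, K t v * K s v ∂m.measure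
  /-- `K*[f] = 1_{[0,t)}` has a solution, namely a Wiener integrand `f = K⁻¹(t, ·)` on `[0,t]` -/
  invertible : ∀ t ∈ Icc 0 T,
    ∃ ψ, SolvesKStar T m K t ((Ico 0 t).indicator fun _ => (1 : ℝ)) ψ

/-! ### The pricing model -/

/-- The data of the pricing model: the maturity `T`, the probability measure `P`, the noise `X` with
its function `m` and its kernel `K`, the excess return `mu` and the initial price `S0`. -/
structure Model (Ω : Type*) [MeasurableSpace Ω] where
  T : ℝ
  P : Measure Ω
  X : ℝ → Ω → ℝ
  m : StieltjesFunction ℝ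
  K : ℝ → ℝ → ℝ
  mu : ℝ → ℝ
  S0 : ℝ

namespace Model

variable {Ω : Type*} [MeasurableSpace Ω] (D : Model Ω)

/-- The standing assumptions on the data of the pricing model. -/
structure Admissible : Prop where
  T_pos : 0 < D.T
  isProb : IsProbabilityMeasure D.P
  noise : IsRIGVolterra D.P D.X D.T D.m D.K
  mu_continuous : ContinuousOn D.mu (Icc 0 D.T)
  mu_boundedVariation : BoundedVariationOn D.mu (Icc 0 D.T)
  S0_pos : 0 < D.S0

/-- `q²(s,t) = q²(t) - q²(s)`, with `q²` the quadratic variation of the noise. -/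
def qsq (s t : ℝ) : ℝ := quadVar D.P D.X D.T t - quadVar D.P D.X D.T s

/-- `q(s,t)`, the square root of `q²(s,t)`. -/
def q (s t : ℝ) : ℝ := √(D.qsq s t)

/-- The discounted asset price `S_t = S_0 exp(μ(t) - q²(t)/2 + X_t)`, the solution of
`dS_t / S_t = dμ(t) + dX_t` (no normalization `μ(0) = 0` is needed in this form). -/
def S (t : ℝ) (ω : Ω) : ℝ :=
  D.S0 * Real.exp (D.mu t - D.mu 0 - 1 / 2 * quadVar D.P D.X D.T t + D.X t ω)

/-- The information `𝓕_t` generated by the asset price up to time `t`. -/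
abbrev F (t : ℝ) : MeasurableSpace Ω :=
  ⨆ s ∈ Icc 0 t, MeasurableSpace.comap (D.S s) inferInstance

/-- `Ψ(t, · | u) = (K*)⁻¹[K(u, ·) - K(t, ·)]` on `[0,u]`. -/
def Psi (t u : ℝ) : ℕ → ℝ →₀ ℝ :=
  kStarInv D.T D.m D.K u ((Ico 0 u).indicator fun s => D.K u s - D.K t s)

/-- `R̂(t,s|u) = R(t,s) - ∫_0^u K(t,v) K(s,v) dm(v)`. -/
def Rhat (t s u : ℝ) : ℝ :=
  ∫ ω, D.X t ω * D.X s ω ∂D.P - ∫ v in (0 : ℝ)..u, D.K t v * D.K s v ∂D.m.measure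

/-- `ρ̂(t|u)`, the square root of `R̂(t,t|u)`. -/
def rhoHat (t u : ℝ) : ℝ := √(D.Rhat t t u)

/-- `β(s,t) = μ(s,t) - q²(s,t)/2`. -/
def beta (s t : ℝ) : ℝ := D.mu t - D.mu s - 1 / 2 * D.qsq s t

/-- `γ(s,t,T) = β(s,t) - q²(t,T)/2`. -/
def gam (s t : ℝ) : ℝ := D.beta s t - 1 / 2 * D.qsq t D.T

/-- The frictionless value function of the claim `f(S_T)`,
`v(t,x) = ∫ f(x exp(-q²(t,T)/2 + q(t,T) z)) φ(z) dz`, where `φ(z) dz = gaussianReal 0 1`. -/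
def value (f : ℝ → ℝ) (t x : ℝ) : ℝ :=
  ∫ z, f (x * Real.exp (-(1 / 2) * D.qsq t D.T + D.q t D.T * z)) ∂(gaussianReal 0 1)

/-- The value process `V^π_t = v(t, S_t)` of the Markovian replicating strategy
`π_t = ∂v/∂x (t, S_t)` of the claim `f(S_T)`. -/
def Vpi (f : ℝ → ℝ) (t : ℝ) (ω : Ω) : ℝ := D.value f t (D.S t ω)

/-- The jump `Δπ^N_{t_j}` of the discrete strategy with position `pos j` on `(t_j, t_{j+1}]`; the
position before `t_0 = 0` is zero. -/
def jump (pos : ℕ → Ω → ℝ) : ℕ → Ω → ℝ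
  | 0, ω => pos 0 ω
  | j + 1, ω => pos (j + 1) ω - pos j ω

/-- The value at time `s ≤ t_N` of the strategy `π^N = ∑_{j < N} pos j · 1_{(t_j, t_{j+1}]}` under
proportional transaction costs `k`: `V_0 + ∫_0^s π^N dS - ∫_0^s k S |dπ^N|`, both integrals being
those of a step process (the jump at `t_j` occurs immediately after `t_j`). -/
def Vdisc (k : ℝ) (N : ℕ) (t : ℕ → ℝ) (V0 : ℝ) (pos : ℕ → Ω → ℝ) (s : ℝ) (ω : Ω) : ℝ :=
  V0 + ∑ j ∈ Finset.range N, pos j ω * (D.S (min s (t (j + 1))) ω - D.S (min s (t j)) ω)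
    - ∑ j ∈ (Finset.range N).filter (fun j => t j < s), k * D.S (t j) ω * |jump pos j ω|

/-- The conditional gain `E[Y_t | 𝓕_u] - Y_u` of a process `Y`. -/
def condGain (Y : ℝ → Ω → ℝ) (t u : ℝ) (ω : Ω) : ℝ := (D.P[Y t | D.F u]) ω - Y u ω

end Model

end GaussVolterra

end

open GaussVolterra

/-! The covariance formula says that the curves `r ↦ X r` in `L²(P)` and `r ↦ K r` in `L²([0,T],
dm)` have the same Gram matrix, so linear combinations of the noise and their limits can be computed
with kernels (`inner_noiseLp`, `inner_eq_of_tendsto`). The operator `K*` sends `1_{[0,r)}` to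
`K(r,·)` (`IsRegularKernel.kStar_indicator`), and invertibility makes every square integrable
function vanishing outside `[0,u)` a limit of combinations of the `K(r,·)`, `r ≤ u`
(`toLp_mem_closure_span`). Hence `Ψ` exists, and so does its Wiener integral `I`.

On the kernel side `X_t - X_u + I` becomes `K(t,·) 1_{(u,T]}`. For `s ≤ u` this is orthogonal to
`K(s,·)`, which vanishes beyond `s`, and its squared norm is `ρ̂²(t|u)`. The closed span of the
noise consists of jointly Gaussian variables, so orthogonality is independence: `X_t` is `X_u - I`,
known at time `u`, plus an independent centered Gaussian variable of variance `ρ̂²`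
(`exists_innovation`).

Price and noise generate the same information. Each gain then follows by freezing the known part and
integrating over the independent one (`condExp_comp_of_indepFun`); for the option value, Fubini's
theorem also puts the two Gaussian integrals in the stated order. -/

namespace GaussVolterra

/-! ### Gaussian variables in `L²` -/

section GaussianLp

variable {Ω : Type*} [MeasurableSpace Ω] {P : Measure Ω}

/-- The elements of a linear subspace of `L²(P)` consisting of Gaussian variables are jointly
Gaussian. -/
lemma isGaussianProcess_of_submodule (H : Submodule ℝ (Lp ℝ 2 P))
    (hH : ∀ ξ ∈ H, HasGaussianLaw ξ P) :
    IsGaussianProcess (fun (ξ : H) ω => (ξ : Lp ℝ 2 P) ω) P where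
  hasGaussianLaw I := by
    classical
    have hmI : AEMeasurable (fun ω => I.restrict (fun ξ : H => (ξ : Lp ℝ 2 P) ω)) P :=
      aemeasurable_pi_lambda _ fun ξ => (Lp.aestronglyMeasurable (ξ : Lp ℝ 2 P)).aemeasurable
    refine ⟨⟨fun L => ?_⟩⟩
    rw [AEMeasurable.map_map_of_aemeasurable (by fun_prop) hmI]
    -- A linear functional of finitely many elements of `H` is again one element of `H`, with the
    -- values of `L` on the standard basis as coefficients.
    have hmem : (∑ ξ : I, L (fun η => if ξ = η then 1 else 0) • ((ξ : H) : Lp ℝ 2 P)) ∈ H :=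
      Submodule.sum_mem _ fun ξ _ => H.smul_mem _ (ξ : H).2
    have hae : (∑ ξ : I, L (fun η => if ξ = η then 1 else 0) • ((ξ : H) : Lp ℝ 2 P) : Lp ℝ 2 P) =ᵐ[P]
        L ∘ fun ω => I.restrict (fun ξ : H => (ξ : Lp ℝ 2 P) ω) := by
      have h1 := Lp.coeFn_finsetSum (p := 2) (μ := P) Finset.univ
        (fun ξ : I => L (fun η => if ξ = η then 1 else 0) • ((ξ : H) : Lp ℝ 2 P))
      have h2 : ∀ᵐ ω ∂P, ∀ ξ : I, (L (fun η => if ξ = η then 1 else 0) • ((ξ : H) : Lp ℝ 2 P) : Lp ℝ 2 P) ω =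
          L (fun η => if ξ = η then 1 else 0) * ((ξ : H) : Lp ℝ 2 P) ω :=
        ae_all_iff.2 fun ξ => by
          filter_upwards [Lp.coeFn_smul (L (fun η => if ξ = η then 1 else 0)) ((ξ : H) : Lp ℝ 2 P)] with ω h
          rw [h]; rfl
      filter_upwards [h1, h2] with ω h1 h2
      rw [h1, Finset.sum_apply]
      simp_rw [h2]
      rw [Function.comp_apply]
      refine Eq.trans ?_ (LinearMap.pi_apply_eq_sum_univ L.toLinearMap
        (I.restrict (fun ξ : H => (ξ : Lp ℝ 2 P) ω))).symm
      exact Finset.sum_congr rfl fun ξ _ => mul_comm _ _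
    exact ((hH _ hmem).congr hae).map_eq_gaussianReal.trans (by
      congr 1
      · rw [integral_map hmI (by fun_prop)]; rfl
      · rw [variance_map (by fun_prop) hmI])

variable [IsProbabilityMeasure P]

lemma integral_abs_le_norm_Lp (ξ : Lp ℝ 2 P) : ∫ ω, |ξ ω| ∂P ≤ ‖ξ‖ := by
  have h1 : eLpNorm ξ 1 P ≤ eLpNorm ξ 2 P :=
    eLpNorm_le_eLpNorm_of_exponent_le (by norm_num) (Lp.aestronglyMeasurable ξ)
  have h2 : ∫ ω, |ξ ω| ∂P = (eLpNorm ξ 1 P).toReal := by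
    rw [eLpNorm_one_eq_lintegral_enorm, ← integral_norm_eq_lintegral_enorm
      (Lp.aestronglyMeasurable ξ)]
    rfl
  rw [h2, Lp.norm_def]
  exact ENNReal.toReal_mono (Lp.eLpNorm_ne_top ξ) h1

lemma integrable_Lp_two (ξ : Lp ℝ 2 P) : Integrable ξ P :=
  (Lp.memLp ξ).integrable (by norm_num)

lemma continuous_integral_Lp : Continuous fun ξ : Lp ℝ 2 P => ∫ ω, ξ ω ∂P := by
  refine LipschitzWith.continuous (K := 1) (LipschitzWith.of_dist_le_mul fun ξ η => ?_)
  rw [NNReal.coe_one, one_mul, Real.dist_eq, ← integral_sub (integrable_Lp_two ξ)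
    (integrable_Lp_two η), dist_eq_norm]
  refine (abs_integral_le_integral_abs).trans (le_trans (le_of_eq ?_) (integral_abs_le_norm_Lp _))
  refine integral_congr_ae ?_
  filter_upwards [Lp.coeFn_sub ξ η] with ω h
  rw [h]; rfl

/-- Since `x ↦ exp(itx)` is `|t|`-Lipschitz, the expectation is Lipschitz for the `L¹` distance,
hence for the `L²` distance. -/
lemma continuous_charFun_Lp (t : ℝ) :
    Continuous fun ξ : Lp ℝ 2 P => ∫ ω, Complex.exp (t * ξ ω * Complex.I) ∂P := by
  have hint (ξ : Lp ℝ 2 P) : Integrable (fun ω => Complex.exp (t * ξ ω * Complex.I)) P := by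
    refine Integrable.of_bound (C := 1) ?_ (ae_of_all _ fun ω => ?_)
    · have := (Lp.aestronglyMeasurable ξ).aemeasurable
      exact AEMeasurable.aestronglyMeasurable (by fun_prop)
    · rw [← Complex.ofReal_mul, Complex.norm_exp_ofReal_mul_I]
  refine LipschitzWith.continuous (K := ‖t‖₊) (LipschitzWith.of_dist_le_mul fun ξ η => ?_)
  rw [dist_eq_norm, ← integral_sub (hint ξ) (hint η), dist_eq_norm]
  have hb : ∀ᵐ ω ∂P, ‖Complex.exp (t * ξ ω * Complex.I) - Complex.exp (t * η ω * Complex.I)‖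
      ≤ |t| * |(ξ - η : Lp ℝ 2 P) ω| := by
    filter_upwards [Lp.coeFn_sub ξ η] with ω h
    have e : Complex.exp (t * ξ ω * Complex.I) - Complex.exp (t * η ω * Complex.I)
        = Complex.exp ((t * η ω : ℝ) * Complex.I) *
          (Complex.exp (Complex.I * (t * (ξ ω - η ω) : ℝ)) - 1) := by
      rw [mul_sub, ← Complex.exp_add]
      push_cast
      ring_nf
    rw [e, norm_mul, Complex.norm_exp_ofReal_mul_I, one_mul, h, ← abs_mul]
    exact Real.norm_exp_I_mul_ofReal_sub_one_le
  refine (norm_integral_le_integral_norm _).trans ?_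
  refine (integral_mono_ae ((hint ξ).sub (hint η)).norm
    ((integrable_Lp_two (ξ - η)).abs.const_mul _) hb).trans ?_
  rw [integral_const_mul]
  exact mul_le_mul_of_nonneg_left (integral_abs_le_norm_Lp _) (abs_nonneg t)

/-- Mean and variance are continuous functions of `ξ` in `L²`, so this form of the characteristic
function criterion makes Gaussianity a closed condition. Degenerate laws count as Gaussian, so
limits of zero variance cause no exception. -/
lemma hasGaussianLaw_Lp_iff (ξ : Lp ℝ 2 P) : HasGaussianLaw ξ P ↔
    ∀ t : ℝ, ∫ ω, Complex.exp (t * ξ ω * Complex.I) ∂P =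
      Complex.exp ((t * ∫ ω, ξ ω ∂P : ℝ) * Complex.I
        - (t ^ 2 * (‖ξ‖ ^ 2 - (∫ ω, ξ ω ∂P) ^ 2) : ℝ) / 2) := by
  have hm : AEMeasurable ξ P := (Lp.aestronglyMeasurable ξ).aemeasurable
  rw [hasGaussianLaw_iff_charFun_map_eq hm]
  refine forall_congr' fun t => ?_
  have h1 : charFun (P.map ξ) t = ∫ ω, Complex.exp (t * ξ ω * Complex.I) ∂P := by
    rw [charFun_apply_real, integral_map hm (by fun_prop)]
  have h2 : ∫ ω, (fun ω => inner ℝ t (ξ ω)) ω ∂P = t * ∫ ω, ξ ω ∂P := by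
    rw [← integral_const_mul]
    exact integral_congr_ae (ae_of_all _ fun ω => by simp [mul_comm])
  have h3 : Var[fun ω => inner ℝ t (ξ ω); P] = t ^ 2 * (‖ξ‖ ^ 2 - (∫ ω, ξ ω ∂P) ^ 2) := by
    have e : (fun ω => inner ℝ t (ξ ω)) = fun ω => t * ξ ω := by
      funext ω; simp [mul_comm]
    rw [e, variance_const_mul, variance_eq_sub (Lp.memLp ξ), ← real_inner_self_eq_norm_sq,
      L2.inner_def]
    congr 2
    exact integral_congr_ae (ae_of_all _ fun ω => by simp [sq])
  rw [h1, h2, h3]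

lemma isClosed_setOf_hasGaussianLaw : IsClosed {ξ : Lp ℝ 2 P | HasGaussianLaw ξ P} := by
  simp_rw [hasGaussianLaw_Lp_iff, ofPred_forall]
  refine isClosed_iInter fun t => isClosed_eq (continuous_charFun_Lp t) ?_
  have := continuous_integral_Lp (P := P)
  fun_prop

end GaussianLp

/-! ### Conditional expectation by freezing the known variable -/

section Freezing

variable {Ω E : Type*} [MeasurableSpace Ω] [MeasurableSpace E] {P : Measure Ω}
  [IsProbabilityMeasure P] {W : Ω → E} {Z : Ω → ℝ}

/-- Independence makes the joint law a product, so the constant kernel with value the law of `Z` is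
a version of the conditional distribution of `Z` given `W`. -/
lemma condExp_of_indepFun {Φ : E × ℝ → ℝ} (hW : Measurable W) (hZ : AEMeasurable Z P)
    (hind : IndepFun W Z P) (hΦ : StronglyMeasurable Φ)
    (hint : Integrable (fun ω => Φ (W ω, Z ω)) P) :
    P[fun ω => Φ (W ω, Z ω) | MeasurableSpace.comap W inferInstance] =ᵐ[P]
      fun ω => ∫ z, Φ (W ω, z) ∂(P.map Z) := by
  have : IsProbabilityMeasure (P.map Z) := Measure.isProbabilityMeasure_map hZ
  have h : condDistrib Z W P =ᵐ[P.map W] Kernel.const E (P.map Z) := by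
    refine condDistrib_ae_eq_of_measure_eq_compProd W hZ ?_
    rw [(indepFun_iff_map_prod_eq_prod_map_map hW.aemeasurable hZ).1 hind,
      Measure.compProd_const]
  refine (condExp_prod_ae_eq_integral_condDistrib hW hZ hΦ hint).trans ?_
  filter_upwards [ae_of_ae_map hW.aemeasurable h] with ω hω
  rw [hω, Kernel.const_apply]

end Freezing

lemma coeFn_linearCombination {α : Type*} [MeasurableSpace α] {μ : Measure α}
    {v : ℝ → Lp ℝ 2 μ} {Y : ℝ → α → ℝ} (c : ℝ →₀ ℝ) (h : ∀ r ∈ c.support, v r =ᵐ[μ] Y r) :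
    Finsupp.linearCombination ℝ v c =ᵐ[μ] fun a => ∑ r ∈ c.support, c r * Y r a := by
  rw [Finsupp.linearCombination_apply, Finsupp.sum]
  have h2 : ∀ᵐ a ∂μ, ∀ r ∈ c.support, (c r • v r : Lp ℝ 2 μ) a = c r * Y r a :=
    (Finset.eventually_all _).2 fun r hr => by
      filter_upwards [Lp.coeFn_smul (c r) (v r), h r hr] with a h1 h2
      rw [h1, Pi.smul_apply, h2, smul_eq_mul]
  filter_upwards [Lp.coeFn_finsetSum (p := 2) (μ := μ) c.support (fun r => c r • v r), h2]
    with a h1 h2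
  rw [h1, Finset.sum_apply]
  exact Finset.sum_congr rfl h2

/-! ### The operator `K*` and its range -/

section Kernel

variable {T : ℝ} {m : StieltjesFunction ℝ} {K : ℝ → ℝ → ℝ}

lemma IsRegularKernel.noAtoms (hK : IsRegularKernel T m K) : NullSingletonClass m.measure :=
  ⟨fun a => by
    rw [StieltjesFunction.measure_singleton,
      hK.m_continuous.continuousAt.continuousWithinAt.leftLim_eq, sub_self, ENNReal.ofReal_zero]⟩

lemma IsRegularKernel.integrableOn_dK (hK : IsRegularKernel T m K) {r s : ℝ} (hs : 0 < s)
    (hsr : s < r) : IntegrableOn (fun t => dK T K t s) (Icc r T) := by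
  refine ContinuousOn.integrableOn_Icc ?_
  refine hK.continuous_dK.comp (f := fun t => (t, s)) (by fun_prop) fun t ht => ?_
  exact ⟨hs, hsr.trans_le ht.1, ht.2⟩

/-- The fundamental theorem of calculus applies because `s < r` keeps the interval away from the
diagonal, where the derivative need not be bounded. -/
lemma IsRegularKernel.setIntegral_dK (hK : IsRegularKernel T m K) {r s : ℝ} (hs : 0 < s)
    (hsr : s < r) (hrT : r ≤ T) : ∫ t in Icc r T, dK T K t s = K T s - K r s := by
  have hint := hK.integrableOn_dK hs hsr
  rw [integral_Icc_eq_integral_Ioc, ← intervalIntegral.integral_of_le hrT]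
  have hd := hK.differentiable s hs
  refine intervalIntegral.integral_eq_sub_of_hasDerivAt_of_le hrT
    (hd.continuousOn.mono fun t ht => ⟨hsr.trans_le ht.1, ht.2⟩) (fun t ht => ?_) ?_
  · have hst := hsr.trans ht.1
    have h1 : DifferentiableAt ℝ (fun t => K t s) t :=
      (hd t ⟨hst, ht.2.le⟩).differentiableAt (Ioc_mem_nhds hst ht.2)
    have h2 : dK T K t s = deriv (fun t => K t s) t :=
      derivWithin_of_mem_nhds (Icc_mem_nhds (hs.trans hst) ht.2)
    rw [h2]
    exact h1.hasDerivAt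
  · exact (intervalIntegrable_iff_integrableOn_Icc_of_le hrT).2 hint

/-- For `s < r` the increment of the indicator is `-1` on `[r,T]` and `0` before, leaving `K(T,s) -
(K(T,s) - K(r,s))`. For `s > r` everything vanishes, including `K(r,s)`. At `s = r` the left side is
`0` while `K(r,r)` need not be. The integrability is what linearity in the step function requires.
-/
lemma IsRegularKernel.kStar_indicator (hK : IsRegularKernel T m K) {r s : ℝ} (hr : r ∈ Icc 0 T)
    (hs : s ∈ Ioc 0 T) (hsr : s ≠ r) :
    IntervalIntegrable (fun t => ((Ico 0 r).indicator (fun _ => (1 : ℝ)) t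
      - (Ico 0 r).indicator (fun _ => (1 : ℝ)) s) * dK T K t s) volume s T ∧
    kStar T K ((Ico 0 r).indicator fun _ => (1 : ℝ)) s = K r s := by
  unfold kStar
  rw [intervalIntegrable_iff_integrableOn_Ioc_of_le hs.2, intervalIntegral.integral_of_le hs.2]
  rcases lt_or_gt_of_ne hsr with h | h
  · have hE : EqOn (fun t => ((Ico 0 r).indicator (fun _ => (1 : ℝ)) t
        - (Ico 0 r).indicator (fun _ => (1 : ℝ)) s) * dK T K t s)
        ((Ici r).indicator fun t => -dK T K t s) (Ioc s T) := by
      intro t ht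
      have h1 : s ∈ Ico 0 r := ⟨hs.1.le, h⟩
      by_cases htr : t < r
      · have h2 : t ∈ Ico 0 r := ⟨hs.1.le.trans ht.1.le, htr⟩
        simp [h1, h2, htr]
      · have h2 : t ∉ Ico 0 r := fun h => htr h.2
        simp [h1, h2, not_lt.1 htr]
    have hset : Ioc s T ∩ Ici r = Icc r T := by
      ext t
      simp only [mem_inter_iff, mem_Ioc, mem_Ici, mem_Icc]
      exact ⟨fun h => ⟨h.2, h.1.2⟩, fun h' => ⟨⟨h.trans_le h'.1, h'.2⟩, h'.1⟩⟩
    constructor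
    · rw [integrableOn_congr_fun hE measurableSet_Ioc, IntegrableOn,
        integrable_indicator_iff measurableSet_Ici, IntegrableOn,
        Measure.restrict_restrict measurableSet_Ici, inter_comm, hset]
      exact (hK.integrableOn_dK hs.1 h).neg
    · rw [setIntegral_congr_fun measurableSet_Ioc hE, setIntegral_indicator measurableSet_Ici,
        hset, integral_neg, hK.setIntegral_dK hs.1 h hr.2,
        indicator_of_mem (show s ∈ Ico 0 r from ⟨hs.1.le, h⟩)]
      ring
  · have hE : EqOn (fun t => ((Ico 0 r).indicator (fun _ => (1 : ℝ)) t
        - (Ico 0 r).indicator (fun _ => (1 : ℝ)) s) * dK T K t s) 0 (Ioc s T) := by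
      intro t ht
      have h1 : s ∉ Ico 0 r := fun h' => h'.2.not_ge h.le
      have h2 : t ∉ Ico 0 r := fun h' => (h'.2.trans h).not_ge ht.1.le
      simp [h1, h2]
    constructor
    · rw [integrableOn_congr_fun hE measurableSet_Ioc]
      exact integrableOn_zero
    · rw [setIntegral_congr_fun measurableSet_Ioc hE, hK.volterra r s h,
        indicator_of_notMem (fun h' => h'.2.not_ge h.le)]
      simp

lemma IsRegularKernel.kStar_stepFn (hK : IsRegularKernel T m K) {c : ℝ →₀ ℝ}
    (hc : ∀ r ∈ c.support, r ∈ Icc 0 T) {s : ℝ} (hs : s ∈ Ioc 0 T) (hsc : s ∉ c.support) :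
    kStar T K (stepFn c) s = ∑ r ∈ c.support, c r * K r s := by
  have hne : ∀ r ∈ c.support, s ≠ r := fun r hr h => hsc (h ▸ hr)
  have h1 : ∀ t, (stepFn c t - stepFn c s) * dK T K t s = ∑ r ∈ c.support, c r *
      (((Ico 0 r).indicator (fun _ => (1 : ℝ)) t
        - (Ico 0 r).indicator (fun _ => (1 : ℝ)) s) * dK T K t s) := by
    intro t
    rw [stepFn, stepFn, Finsupp.sum, Finsupp.sum, ← Finset.sum_sub_distrib, Finset.sum_mul]
    exact Finset.sum_congr rfl fun r _ => by ring
  rw [kStar, intervalIntegral.integral_congr (fun t _ => h1 t),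
    intervalIntegral.integral_finsetSum
      fun r hr => (hK.kStar_indicator (hc r hr) hs (hne r hr)).1.const_mul _,
    stepFn, Finsupp.sum, Finset.sum_mul, ← Finset.sum_add_distrib]
  refine Finset.sum_congr rfl fun r hr => ?_
  rw [← (hK.kStar_indicator (hc r hr) hs (hne r hr)).2, kStar,
    intervalIntegral.integral_const_mul]
  ring

open Classical in
/-- The section `K(r, ·)` as an element of `L²([0,T], dm)`. -/
noncomputable def kernelLp (hK : IsRegularKernel T m K) (r : ℝ) :
    Lp ℝ 2 (m.measure.restrict (Icc 0 T)) :=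
  if h : r ∈ Icc 0 T then (hK.memLp_section r h).toLp else 0

lemma coeFn_kernelLp (hK : IsRegularKernel T m K) {r : ℝ} (hr : r ∈ Icc 0 T) :
    kernelLp hK r =ᵐ[m.measure.restrict (Icc 0 T)] K r := by
  rw [kernelLp, dif_pos hr]
  exact (hK.memLp_section r hr).coeFn_toLp

lemma coeFn_linearCombination_kernelLp (hK : IsRegularKernel T m K) {c : ℝ →₀ ℝ}
    (hc : ∀ r ∈ c.support, r ∈ Icc 0 T) :
    Finsupp.linearCombination ℝ (kernelLp hK) c =ᵐ[m.measure.restrict (Icc 0 T)]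
      kStar T K (stepFn c) := by
  have := hK.noAtoms
  -- The kernel is regular only for `s > 0`, and the formula for `K*` may fail at the finitely many
  -- jump points; `m` has no atoms, so all of these are negligible.
  have h0 : ∀ᵐ s ∂m.measure.restrict (Icc 0 T), s ≠ 0 := Measure.ae_ne _ _
  have h1 : ∀ᵐ s ∂m.measure.restrict (Icc 0 T), s ∉ c.support :=
    measure_eq_zero_iff_ae_notMem.1 (c.support.measure_zero _)
  filter_upwards [coeFn_linearCombination c fun r hr => coeFn_kernelLp hK (hc r hr), h0, h1,
    ae_restrict_mem measurableSet_Icc] with s h2 h0 h1 hs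
  rw [h2, hK.kStar_stepFn hc ⟨lt_of_le_of_ne hs.1 h0.symm, hs.2⟩ h1]

lemma solvesKStar_iff (hK : IsRegularKernel T m K) {u : ℝ} (hu : u ≤ T) {g : ℝ → ℝ}
    (hg : MemLp g 2 (m.measure.restrict (Icc 0 T))) (ψ : ℕ → ℝ →₀ ℝ) :
    SolvesKStar T m K u g ψ ↔ (∀ n, ∀ r ∈ (ψ n).support, r ∈ Icc 0 u) ∧
      Tendsto (fun n => Finsupp.linearCombination ℝ (kernelLp hK) (ψ n)) atTop
        (𝓝 (hg.toLp g)) := by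
  refine and_congr_right fun h => ?_
  rw [Lp.tendsto_Lp_iff_tendsto_eLpNorm]
  refine tendsto_congr fun n => eLpNorm_congr_ae ?_
  filter_upwards [coeFn_linearCombination_kernelLp hK
    fun r hr => Icc_subset_Icc_right hu (h n r hr)] with s hs
  rw [Pi.sub_apply, hs]

/-- The half-lines form a π-system generating the Borel sets. The sets over which `h` has zero
integral are closed under complements, because the total integral is zero, and under countable
disjoint unions. -/
lemma ae_eq_zero_of_setIntegral_Ico_eq_zero {ν : Measure ℝ} {h : ℝ → ℝ} {u : ℝ}
    (hint : IntegrableOn h (Ico 0 u) ν)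
    (h0 : ∀ s ∈ Icc 0 u, ∫ x in Ico 0 s, h x ∂ν = 0) : h =ᵐ[ν.restrict (Ico 0 u)] 0 := by
  have hIio (s : ℝ) : ∫ x in Iio s, h x ∂(ν.restrict (Ico 0 u)) = 0 := by
    rw [Measure.restrict_restrict measurableSet_Iio]
    have e : Iio s ∩ Ico 0 u = Ico 0 (min s u) := by
      ext x
      simp only [mem_inter_iff, mem_Iio, mem_Ico, lt_min_iff]
      tauto
    rw [e]
    rcases le_or_gt 0 (min s u) with hs | hs
    · exact h0 _ ⟨hs, min_le_right _ _⟩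
    · rw [Ico_eq_empty_of_le hs.le, setIntegral_empty]
  have huniv : ∫ x, h x ∂(ν.restrict (Ico 0 u)) = 0 := by
    have := hIio u
    rwa [Measure.restrict_restrict measurableSet_Iio,
      inter_eq_right.2 (Ico_subset_Iio_self)] at this
  refine Integrable.ae_eq_zero_of_forall_setIntegral_eq_zero hint fun A hA _ => ?_
  refine MeasurableSpace.induction_on_inter
    (C := fun A _ => ∫ x in A, h x ∂(ν.restrict (Ico 0 u)) = 0)
    (BorelSpace.measurable_eq.trans (borel_eq_generateFrom_Iio ℝ)) isPiSystem_Iio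
    ?_ ?_ ?_ ?_ A hA
  · simp
  · rintro _ ⟨s, rfl⟩
    exact hIio s
  · intro A hA h
    have := integral_add_compl hA hint
    rw [h, zero_add, huniv] at this
    exact this
  · intro f hd hm h
    rw [integral_iUnion hm hd hint.integrableOn]
    simp [h]

/-- The Wiener integrands on `[0,u]` are mapped by `K*` onto the functions in `L²([0,T], dm)`
vanishing outside `[0,u)`. -/
lemma toLp_mem_closure_span (hK : IsRegularKernel T m K) {u : ℝ} (hu : u ∈ Icc 0 T)
    (hinv : ∀ t ∈ Icc 0 T,
      ∃ ψ, SolvesKStar T m K t ((Ico 0 t).indicator fun _ => (1 : ℝ)) ψ) {g : ℝ → ℝ}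
    (hg : MemLp g 2 (m.measure.restrict (Icc 0 T))) (hg0 : ∀ s ∉ Ico 0 u, g s = 0) :
    hg.toLp g ∈ (Submodule.span ℝ (kernelLp hK '' Icc 0 u)).topologicalClosure := by
  set ν := m.measure.restrict (Icc 0 T)
  have : IsFiniteMeasure ν := ⟨by simp [ν]⟩
  set C := (Submodule.span ℝ (kernelLp hK '' Icc 0 u)).topologicalClosure with hC
  have hind (s : ℝ) : MemLp ((Ico 0 s).indicator fun _ => (1 : ℝ)) 2 ν :=
    (memLp_const 1).indicator measurableSet_Ico
  have hindC : ∀ s ∈ Icc 0 u, (hind s).toLp _ ∈ C := by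
    intro s hs
    obtain ⟨ψ, hψ⟩ := hinv s ⟨hs.1, hs.2.trans hu.2⟩
    rw [solvesKStar_iff hK (hs.2.trans hu.2) (hind s)] at hψ
    refine mem_closure_of_tendsto hψ.2 (Eventually.of_forall fun n => ?_)
    refine (Finsupp.mem_span_image_iff_linearCombination ℝ).2 ?_
    exact ⟨ψ n, (Finsupp.mem_supported ℝ _).2 fun r hr => ⟨(hψ.1 n r hr).1,
      (hψ.1 n r hr).2.trans hs.2⟩, rfl⟩
  have : C.HasOrthogonalProjection := by
    have : CompleteSpace C := (Submodule.isClosed_topologicalClosure _).completeSpace_coe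
    infer_instance
  -- As `C` is closed, it suffices to test against `η` orthogonal to `C`. Such an `η` integrates to
  -- zero over every `[0,s)` with `s ≤ u`, so it vanishes on `[0,u)`, and `g` vanishes elsewhere.
  rw [← Submodule.orthogonal_orthogonal C, Submodule.mem_orthogonal]
  intro η hη
  have hη0 : η =ᵐ[ν.restrict (Ico 0 u)] 0 := by
    refine ae_eq_zero_of_setIntegral_Ico_eq_zero
      ((Lp.memLp η).integrable (by norm_num)).integrableOn fun s hs => ?_
    have h := (Submodule.mem_orthogonal C η).1 hη _ (hindC s hs)
    rw [L2.inner_def] at h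
    rw [← integral_indicator measurableSet_Ico]
    refine Eq.trans ?_ h
    refine integral_congr_ae ?_
    filter_upwards [(hind s).coeFn_toLp] with x hx
    rw [hx]
    by_cases hxs : x ∈ Ico 0 s <;> simp [hxs, -mem_Ico]
  rw [L2.inner_def]
  refine integral_eq_zero_of_ae ?_
  filter_upwards [hg.coeFn_toLp, (ae_restrict_iff' measurableSet_Ico).1 hη0] with x hx hx0
  rw [hx]
  by_cases hxu : x ∈ Ico 0 u
  · simp [hx0 hxu]
  · simp [hg0 x hxu]

lemma exists_solvesKStar (hK : IsRegularKernel T m K) {u : ℝ} (hu : u ∈ Icc 0 T)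
    (hinv : ∀ t ∈ Icc 0 T,
      ∃ ψ, SolvesKStar T m K t ((Ico 0 t).indicator fun _ => (1 : ℝ)) ψ) {g : ℝ → ℝ}
    (hg : MemLp g 2 (m.measure.restrict (Icc 0 T))) (hg0 : ∀ s ∉ Ico 0 u, g s = 0) :
    ∃ ψ, SolvesKStar T m K u g ψ := by
  obtain ⟨x, hx, hlim⟩ := mem_closure_iff_seq_limit.1 (toLp_mem_closure_span hK hu hinv hg hg0)
  choose ψ hψ hψx using fun n => (Finsupp.mem_span_image_iff_linearCombination ℝ).1 (hx n)
  refine ⟨ψ, (solvesKStar_iff hK hu.2 hg ψ).2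
    ⟨fun n r hr => (Finsupp.mem_supported ℝ _).1 (hψ n) hr, ?_⟩⟩
  simpa only [hψx] using hlim

end Kernel

lemma linearCombination_single_sub_single_add {V : Type*} [AddCommGroup V] [Module ℝ V]
    (v : ℝ → V) (t u : ℝ) (c : ℝ →₀ ℝ) :
    Finsupp.linearCombination ℝ v (Finsupp.single t 1 - Finsupp.single u 1 + c) =
      v t - v u + Finsupp.linearCombination ℝ v c := by
  simp

/-! ### Transfer between families with the same Gram matrix -/

section Transfer

variable {H G : Type*} [NormedAddCommGroup H] [InnerProductSpace ℝ H] [NormedAddCommGroup G]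
  [InnerProductSpace ℝ G] {x : ℝ → H} {k : ℝ → G}

lemma inner_linearCombination_eq (h : ∀ r s, inner ℝ (x r) (x s) = inner ℝ (k r) (k s))
    (c d : ℝ →₀ ℝ) :
    inner ℝ (Finsupp.linearCombination ℝ x c) (Finsupp.linearCombination ℝ x d) =
      inner ℝ (Finsupp.linearCombination ℝ k c) (Finsupp.linearCombination ℝ k d) := by
  simp only [Finsupp.linearCombination_apply, Finsupp.sum, sum_inner, inner_sum,
    real_inner_smul_left, real_inner_smul_right, h]

lemma norm_linearCombination_eq (h : ∀ r s, inner ℝ (x r) (x s) = inner ℝ (k r) (k s))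
    (c : ℝ →₀ ℝ) :
    ‖Finsupp.linearCombination ℝ x c‖ = ‖Finsupp.linearCombination ℝ k c‖ := by
  rw [@norm_eq_sqrt_real_inner H, @norm_eq_sqrt_real_inner G, inner_linearCombination_eq h]

/-- Equal Gram matrices give equal norms of differences, so the Cauchy property passes from one side
to the other. -/
lemma exists_tendsto_linearCombination [CompleteSpace H]
    (h : ∀ r s, inner ℝ (x r) (x s) = inner ℝ (k r) (k s)) {c : ℕ → ℝ →₀ ℝ} {w : G}
    (hw : Tendsto (fun n => Finsupp.linearCombination ℝ k (c n)) atTop (𝓝 w)) :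
    ∃ ξ, Tendsto (fun n => Finsupp.linearCombination ℝ x (c n)) atTop (𝓝 ξ) := by
  refine cauchySeq_tendsto_of_complete ?_
  have := hw.cauchySeq
  rw [Metric.cauchySeq_iff] at this ⊢
  simpa only [dist_eq_norm, ← map_sub, norm_linearCombination_eq h] using this

lemma inner_eq_of_tendsto (h : ∀ r s, inner ℝ (x r) (x s) = inner ℝ (k r) (k s))
    {c : ℕ → ℝ →₀ ℝ} {w : G} {ξ : H}
    (hw : Tendsto (fun n => Finsupp.linearCombination ℝ k (c n)) atTop (𝓝 w))
    (hξ : Tendsto (fun n => Finsupp.linearCombination ℝ x (c n)) atTop (𝓝 ξ)) (s : ℝ) :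
    inner ℝ ξ (x s) = inner ℝ w (k s) := by
  refine tendsto_nhds_unique (hξ.inner tendsto_const_nhds)
    ((hw.inner tendsto_const_nhds).congr fun n => ?_)
  have := inner_linearCombination_eq h (c n) (Finsupp.single s 1)
  simpa using this.symm

lemma norm_eq_of_tendsto (h : ∀ r s, inner ℝ (x r) (x s) = inner ℝ (k r) (k s))
    {c : ℕ → ℝ →₀ ℝ} {w : G} {ξ : H}
    (hw : Tendsto (fun n => Finsupp.linearCombination ℝ k (c n)) atTop (𝓝 w))
    (hξ : Tendsto (fun n => Finsupp.linearCombination ℝ x (c n)) atTop (𝓝 ξ)) : ‖ξ‖ = ‖w‖ :=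
  tendsto_nhds_unique hξ.norm (hw.norm.congr fun n => (norm_linearCombination_eq h (c n)).symm)

end Transfer

/-! ### The noise, its first chaos and the innovation -/

section Noise

/-- The σ-algebra generated by the noise up to time `u`. -/
abbrev noiseFiltration {Ω : Type*} (X : ℝ → Ω → ℝ) (u : ℝ) : MeasurableSpace Ω :=
  ⨆ s ∈ Icc 0 u, MeasurableSpace.comap (X s) inferInstance

lemma measurable_noiseFiltration {Ω : Type*} {X : ℝ → Ω → ℝ} {u s : ℝ} (hs : s ∈ Icc 0 u) :
    Measurable[noiseFiltration X u] (X s) :=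
  measurable_iff_comap_le.2 (le_iSup₂_of_le s hs le_rfl)

lemma noiseFiltration_eq_comap {Ω : Type*} (X : ℝ → Ω → ℝ) (u : ℝ) :
    noiseFiltration X u =
      MeasurableSpace.comap (fun ω (s : Icc (0 : ℝ) u) => X s ω) inferInstance := by
  rw [noiseFiltration, iSup_subtype', MeasurableSpace.pi, MeasurableSpace.comap_iSup]
  simp_rw [MeasurableSpace.comap_comp]
  rfl

variable {Ω : Type*} [MeasurableSpace Ω] {P : Measure Ω} {X : ℝ → Ω → ℝ} {T : ℝ}
  {m : StieltjesFunction ℝ} {K : ℝ → ℝ → ℝ}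

lemma IsRIGVolterra.hasGaussianLaw (hX : IsRIGVolterra P X T m K) {r : ℝ} (hr : r ∈ Icc 0 T) :
    HasGaussianLaw (X r) P :=
  hX.gaussian.hasGaussianLaw_eval ⟨r, hr⟩

lemma IsRIGVolterra.memLp (hX : IsRIGVolterra P X T m K) {r : ℝ} (hr : r ∈ Icc 0 T) :
    MemLp (X r) 2 P :=
  (hX.hasGaussianLaw hr).memLp (by norm_num)

open Classical in
/-- The noise as a curve in `L²(P)`. -/
noncomputable def noiseLp (hX : IsRIGVolterra P X T m K) (r : ℝ) : Lp ℝ 2 P :=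
  if h : r ∈ Icc 0 T then (hX.memLp h).toLp else 0

lemma coeFn_noiseLp (hX : IsRIGVolterra P X T m K) {r : ℝ} (hr : r ∈ Icc 0 T) :
    noiseLp hX r =ᵐ[P] X r := by
  rw [noiseLp, dif_pos hr]
  exact (hX.memLp hr).coeFn_toLp

/-- The factor `K(s,v)` vanishes for `v > s`, so nothing is added by integrating beyond `u ≥ s`. -/
lemma intervalIntegral_kernel_mul (hK : IsRegularKernel T m K) {t s u : ℝ} (hs : s ≤ u)
    (hu : u ∈ Icc 0 T) :
    ∫ v in (0 : ℝ)..u, K t v * K s v ∂m.measure =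
      ∫ v in Icc 0 T, K t v * K s v ∂m.measure := by
  have := hK.noAtoms
  rw [intervalIntegral.integral_of_le hu.1, ← integral_Icc_eq_integral_Ioc]
  refine (setIntegral_eq_of_subset_of_forall_sdiff_eq_zero measurableSet_Icc
    (Icc_subset_Icc_right hu.2) fun v hv => ?_).symm
  rw [hK.volterra s v (hs.trans_lt (not_le.1 fun h => hv.2 ⟨hv.1.1, h⟩)), mul_zero]

/-- This is the covariance formula. Both curves are set to `0` outside `[0,T]`, so the identity
holds for all real indices, as the transfer lemmas demand. -/
lemma inner_noiseLp (hX : IsRIGVolterra P X T m K) (r s : ℝ) :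
    inner ℝ (noiseLp hX r) (noiseLp hX s) =
      inner ℝ (kernelLp hX.kernel r) (kernelLp hX.kernel s) := by
  by_cases hr : r ∈ Icc 0 T
  · by_cases hs : s ∈ Icc 0 T
    · have h1 : inner ℝ (noiseLp hX r) (noiseLp hX s) = ∫ ω, X r ω * X s ω ∂P := by
        rw [L2.inner_def]
        refine integral_congr_ae ?_
        filter_upwards [coeFn_noiseLp hX hr, coeFn_noiseLp hX hs] with ω h1 h2
        rw [h1, h2, real_inner_eq_re_inner ℝ]
        simp [mul_comm]
      have h2 : inner ℝ (kernelLp hX.kernel r) (kernelLp hX.kernel s) =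
          ∫ v in Icc 0 T, K r v * K s v ∂m.measure := by
        rw [L2.inner_def]
        refine integral_congr_ae ?_
        filter_upwards [coeFn_kernelLp hX.kernel hr, coeFn_kernelLp hX.kernel hs] with ω h1 h2
        rw [h1, h2]
        simp [mul_comm]
      rw [h1, h2, hX.covariance r hr s hs]
      rcases le_total r s with h | h
      · rw [min_eq_left h]
        simpa only [mul_comm] using intervalIntegral_kernel_mul hX.kernel (t := s) le_rfl hr
      · rw [min_eq_right h, intervalIntegral_kernel_mul hX.kernel le_rfl hs]
    · rw [noiseLp, noiseLp, kernelLp, kernelLp, dif_neg hs, dif_neg hs, inner_zero_right,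
        inner_zero_right]
  · rw [noiseLp, kernelLp, dif_neg hr, dif_neg hr, inner_zero_left, inner_zero_left]

lemma coeFn_linearCombination_noiseLp (hX : IsRIGVolterra P X T m K) {c : ℝ →₀ ℝ}
    (hc : ∀ r ∈ c.support, r ∈ Icc 0 T) :
    Finsupp.linearCombination ℝ (noiseLp hX) c =ᵐ[P] stepInt X c :=
  coeFn_linearCombination c fun r hr => coeFn_noiseLp hX (hc r hr)

lemma hasWienerInt_iff (hX : IsRIGVolterra P X T m K) {ψ : ℕ → ℝ →₀ ℝ}
    (hψ : ∀ n, ∀ r ∈ (ψ n).support, r ∈ Icc 0 T) (I : Ω → ℝ) :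
    HasWienerInt P X ψ I ↔ ∃ h : MemLp I 2 P,
      Tendsto (fun n => Finsupp.linearCombination ℝ (noiseLp hX) (ψ n)) atTop (𝓝 (h.toLp I)) := by
  rw [HasWienerInt, ← exists_prop]
  refine exists_congr fun h => ?_
  rw [Lp.tendsto_Lp_iff_tendsto_eLpNorm]
  refine tendsto_congr fun n => eLpNorm_congr_ae ?_
  filter_upwards [coeFn_linearCombination_noiseLp hX (hψ n)] with ω hω
  rw [Pi.sub_apply, hω]

/-- The Wiener integral of `(K*)⁻¹[g]` exists, and it is the limit of the step integrals. -/
lemma exists_wienerInt_kStarInv (hX : IsRIGVolterra P X T m K) {u : ℝ} (hu : u ∈ Icc 0 T)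
    {g : ℝ → ℝ} (hg : MemLp g 2 (m.measure.restrict (Icc 0 T))) (hg0 : ∀ s ∉ Ico 0 u, g s = 0) :
    ∃ ψ : ℕ → ℝ →₀ ℝ, (∀ n, ∀ r ∈ (ψ n).support, r ∈ Icc 0 u) ∧
      Tendsto (fun n => Finsupp.linearCombination ℝ (kernelLp hX.kernel) (ψ n)) atTop
        (𝓝 (hg.toLp g)) ∧
      ∃ h : MemLp (wienerInt P X (kStarInv T m K u g)) 2 P,
        Tendsto (fun n => Finsupp.linearCombination ℝ (noiseLp hX) (ψ n)) atTop
          (𝓝 (h.toLp _)) := by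
  -- Existence of a solution here, and of a limit in `hI` below, shows that neither choice falls
  -- back on its default value `0`.
  have hex := exists_solvesKStar hX.kernel hu hX.invertible hg hg0
  have hsol : SolvesKStar T m K u g (kStarInv T m K u g) := by
    rw [kStarInv, dif_pos hex]
    exact hex.choose_spec
  rw [solvesKStar_iff hX.kernel hu.2 hg] at hsol
  have hsupp : ∀ n, ∀ r ∈ (kStarInv T m K u g n).support, r ∈ Icc 0 T :=
    fun n r hr => Icc_subset_Icc_right hu.2 (hsol.1 n r hr)
  refine ⟨_, hsol.1, hsol.2, ?_⟩
  rw [← hasWienerInt_iff hX hsupp]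
  have hI : ∃ I, HasWienerInt P X (kStarInv T m K u g) I := by
    obtain ⟨ξ, hξ⟩ := exists_tendsto_linearCombination (inner_noiseLp hX) hsol.2
    exact ⟨ξ, (hasWienerInt_iff hX hsupp _).2 ⟨Lp.memLp ξ, by rwa [Lp.toLp_coeFn]⟩⟩
  rw [wienerInt, dif_pos hI]
  exact hI.choose_spec

/-- The first chaos of the noise. -/
noncomputable def chaos (hX : IsRIGVolterra P X T m K) : Submodule ℝ (Lp ℝ 2 P) :=
  (Submodule.span ℝ (noiseLp hX '' Icc 0 T)).topologicalClosure

lemma noiseLp_mem_chaos (hX : IsRIGVolterra P X T m K) {r : ℝ} (hr : r ∈ Icc 0 T) :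
    noiseLp hX r ∈ chaos hX :=
  Submodule.le_topologicalClosure _ (Submodule.subset_span ⟨r, hr, rfl⟩)

lemma linearCombination_mem_chaos (hX : IsRIGVolterra P X T m K) {c : ℝ →₀ ℝ}
    (hc : ∀ r ∈ c.support, r ∈ Icc 0 T) :
    Finsupp.linearCombination ℝ (noiseLp hX) c ∈ chaos hX :=
  Submodule.le_topologicalClosure _ ((Finsupp.mem_span_image_iff_linearCombination ℝ).2
    ⟨c, (Finsupp.mem_supported ℝ _).2 hc, rfl⟩)

/-- Finite combinations of the noise are Gaussian, and Gaussianity is closed in `L²`. -/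
lemma hasGaussianLaw_of_mem_chaos [IsProbabilityMeasure P] (hX : IsRIGVolterra P X T m K)
    {ξ : Lp ℝ 2 P} (hξ : ξ ∈ chaos hX) : HasGaussianLaw ξ P := by
  classical
  refine closure_minimal (t := {ξ : Lp ℝ 2 P | HasGaussianLaw ξ P}) (fun η hη => ?_)
    isClosed_setOf_hasGaussianLaw hξ
  obtain ⟨c, hc, rfl⟩ := (Finsupp.mem_span_image_iff_linearCombination ℝ).1 hη
  have hc' : ∀ r ∈ c.support, r ∈ Icc 0 T := fun r hr => (Finsupp.mem_supported ℝ _).1 hc hr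
  refine HasGaussianLaw.congr ?_ (coeFn_linearCombination_noiseLp hX hc').symm
  have h := (hX.gaussian.smul fun r : Icc (0 : ℝ) T => c r).hasGaussianLaw_fun_sum
    (I := c.support.subtype (· ∈ Icc 0 T))
  refine h.congr (ae_of_all _ fun ω => ?_)
  exact (Finset.sum_subtype_of_mem (fun r => c r * X r ω) hc')

lemma noiseFiltration_le (hX : IsRIGVolterra P X T m K) {u : ℝ} (hu : u ≤ T) :
    noiseFiltration X u ≤ ‹MeasurableSpace Ω› :=
  iSup₂_le fun _ hs => (hX.measurable _ ⟨hs.1, hs.2.trans hu⟩).comap_le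

/-- An element of the first chaos orthogonal to the noise up to time `u` is independent of it. -/
lemma indepFun_of_mem_chaos [IsProbabilityMeasure P] (hX : IsRIGVolterra P X T m K) {u : ℝ}
    (hu : u ≤ T) {ξ : Lp ℝ 2 P} (hξ : ξ ∈ chaos hX)
    (horth : ∀ s ∈ Icc 0 u, inner ℝ ξ (noiseLp hX s) = 0) {Z : Ω → ℝ} (hZ : Measurable Z)
    (hZξ : ξ =ᵐ[P] Z) : @IndepFun Ω Ω ℝ _ (noiseFiltration X u) _ id Z P := by
  have hs (s : Icc (0 : ℝ) u) : (s : ℝ) ∈ Icc 0 T := Icc_subset_Icc_right hu s.2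
  have hG : IsGaussianProcess (Sum.elim (fun _ : Unit => Z) fun s : Icc (0 : ℝ) u => X s) P := by
    refine ((isGaussianProcess_of_submodule (chaos hX)
      fun ξ hξ => hasGaussianLaw_of_mem_chaos hX hξ).comp_right
      (Sum.elim (fun _ : Unit => ⟨ξ, hξ⟩)
        fun s : Icc (0 : ℝ) u => ⟨noiseLp hX s, noiseLp_mem_chaos hX (hs s)⟩)).congr ?_
    rintro (_ | s)
    · exact hZξ
    · exact coeFn_noiseLp hX (hs s)
  have hind := hG.indepFun_of_covariance_eq_zero (fun _ => hZ.aemeasurable)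
    -- The noise is centered, so the covariance with `X s` is the `L²` inner product, zero by
    -- `horth`.
    (fun s => (hX.measurable s (hs s)).aemeasurable) fun _ s => by
      rw [covariance_eq_sub ((memLp_congr_ae hZξ).1 (Lp.memLp ξ)) (hX.memLp (hs s)),
        hX.centered s (hs s), mul_zero, sub_zero]
      refine Eq.trans ?_ (horth s s.2)
      rw [L2.inner_def]
      refine integral_congr_ae ?_
      filter_upwards [hZξ, coeFn_noiseLp hX (hs s)] with ω h1 h2
      rw [h1, h2]
      simp [mul_comm]
  have h2 := (hind.comp (φ := fun f : Unit → ℝ => f ()) (ψ := id)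
    (measurable_pi_apply (X := fun _ : Unit => ℝ) ()) measurable_id).symm
  rw [IndepFun_iff_Indep] at h2
  refine (@IndepFun_iff_Indep Ω Ω ℝ _ (noiseFiltration X u) _ id Z P).2 ?_
  rw [MeasurableSpace.comap_id, noiseFiltration_eq_comap]
  exact h2

/-- Given the noise up to time `u`, the variable `X t` is the sum of a known part and of an
independent centered Gaussian variable. -/
theorem exists_innovation [IsProbabilityMeasure P] (hX : IsRIGVolterra P X T m K) {u t : ℝ}
    (hu : u ∈ Icc 0 T) (ht : t ∈ Icc 0 T) :
    ∃ A : Ω → ℝ, Measurable[noiseFiltration X u] A ∧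
      A =ᵐ[P] wienerInt P X (kStarInv T m K u ((Ico 0 u).indicator fun s => K u s - K t s)) ∧
      @IndepFun Ω Ω ℝ _ (noiseFiltration X u) _ id (fun ω => X t ω - X u ω + A ω) P ∧
      0 ≤ ∫ ω, X t ω * X t ω ∂P - ∫ v in (0 : ℝ)..u, K t v * K t v ∂m.measure ∧
      P.map (fun ω => X t ω - X u ω + A ω) = gaussianReal 0
        (∫ ω, X t ω * X t ω ∂P - ∫ v in (0 : ℝ)..u, K t v * K t v ∂m.measure).toNNReal := by
  have hK := hX.kernel
  have := hK.noAtoms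
  have hF := noiseFiltration_le hX hu.2
  set g := (Ico 0 u).indicator fun s => K u s - K t s with hgdef
  have hg : MemLp g 2 (m.measure.restrict (Icc 0 T)) :=
    ((hK.memLp_section u hu).sub (hK.memLp_section t ht)).indicator measurableSet_Ico
  obtain ⟨ψ, hψ, hψk, hI, hψx⟩ := exists_wienerInt_kStarInv hX hu hg
    fun s hs => indicator_of_notMem hs _
  set I := wienerInt P X (kStarInv T m K u g)
  have hψT : ∀ n, ∀ r ∈ (ψ n).support, r ∈ Icc 0 T :=
    fun n r hr => Icc_subset_Icc_right hu.2 (hψ n r hr)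
  have hIm : AEStronglyMeasurable[noiseFiltration X u] (hI.toLp I) P := by
    refine (isClosed_aestronglyMeasurable (p := 2) (F := ℝ) (μ := P) hF).mem_of_tendsto hψx
      (Eventually.of_forall fun n => ?_)
    refine AEStronglyMeasurable.congr (Measurable.stronglyMeasurable ?_).aestronglyMeasurable
      (coeFn_linearCombination_noiseLp hX (hψT n)).symm
    exact Finset.measurable_sum _ fun r hr =>
      (measurable_noiseFiltration (hψ n r hr)).const_mul _
  -- The Wiener integral is determined only up to null sets; `A` is a version measurable for the
  -- past of the noise.
  obtain ⟨A, hAm, hA⟩ := hIm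
  have hAI : A =ᵐ[P] I := hA.symm.trans hI.coeFn_toLp
  have hA' : Measurable A := hAm.measurable.mono hF le_rfl
  set Z : Ω → ℝ := fun ω => X t ω - X u ω + A ω with hZdef
  have hZ : Measurable Z := ((hX.measurable t ht).sub (hX.measurable u hu)).add hA'
  -- The same coefficients approximate `ζ` on the noise side and `w` on the kernel side, so inner
  -- products and norms of `ζ` can be read off from `w`.
  set c : ℕ → ℝ →₀ ℝ := fun n => Finsupp.single t 1 - Finsupp.single u 1 + ψ n with hc
  set ζ : Lp ℝ 2 P := noiseLp hX t - noiseLp hX u + hI.toLp I with hζdef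
  set w := kernelLp hK t - kernelLp hK u + hg.toLp g with hwdef
  have hcx : Tendsto (fun n => Finsupp.linearCombination ℝ (noiseLp hX) (c n)) atTop (𝓝 ζ) := by
    simp only [hc, linearCombination_single_sub_single_add]
    exact tendsto_const_nhds.add hψx
  have hck : Tendsto (fun n => Finsupp.linearCombination ℝ (kernelLp hK) (c n)) atTop (𝓝 w) := by
    simp only [hc, linearCombination_single_sub_single_add]
    exact tendsto_const_nhds.add hψk
  -- Below `u` the function `g` cancels `K(t,·) - K(u,·)`; above `u` it is zero and so is `K(u,·)`.
  -- The point `u` itself is negligible.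
  have hw : w =ᵐ[m.measure.restrict (Icc 0 T)] (Ioi u).indicator (K t) := by
    have hne : ∀ᵐ s ∂m.measure.restrict (Icc 0 T), s ≠ u := Measure.ae_ne _ _
    filter_upwards [Lp.coeFn_add (kernelLp hK t - kernelLp hK u) (hg.toLp g),
      Lp.coeFn_sub (kernelLp hK t) (kernelLp hK u), hg.coeFn_toLp, coeFn_kernelLp hK ht,
      coeFn_kernelLp hK hu, hne, ae_restrict_mem measurableSet_Icc] with s h1 h2 h3 h4 h5 h6 h7
    rw [h1, Pi.add_apply, h2, Pi.sub_apply, h3, h4, h5, hgdef]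
    rcases lt_or_gt_of_ne h6 with h | h
    · rw [indicator_of_mem (show s ∈ Ico 0 u from ⟨h7.1, h⟩),
        indicator_of_notMem (show s ∉ Ioi u from h.not_gt)]
      ring
    · rw [indicator_of_notMem (show s ∉ Ico 0 u from fun h' => h'.2.not_gt h),
        indicator_of_mem (show s ∈ Ioi u from h), hK.volterra u s h]
      ring
  have hζZ : ζ =ᵐ[P] Z := by
    filter_upwards [Lp.coeFn_add (noiseLp hX t - noiseLp hX u) (hI.toLp I),
      Lp.coeFn_sub (noiseLp hX t) (noiseLp hX u), hA, coeFn_noiseLp hX ht,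
      coeFn_noiseLp hX hu] with ω h1 h2 h3 h4 h5
    rw [h1, Pi.add_apply, h2, Pi.sub_apply, h3, h4, h5]
  have hζmem : ζ ∈ chaos hX := by
    refine Submodule.add_mem _ (Submodule.sub_mem _ (noiseLp_mem_chaos hX ht)
      (noiseLp_mem_chaos hX hu)) ?_
    exact (Submodule.isClosed_topologicalClosure _).mem_of_tendsto hψx
      (Eventually.of_forall fun n => linearCombination_mem_chaos hX (hψT n))
  have horth : ∀ s ∈ Icc 0 u, inner ℝ ζ (noiseLp hX s) = 0 := by
    intro s hs
    rw [inner_eq_of_tendsto (inner_noiseLp hX) hck hcx, L2.inner_def]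
    refine integral_eq_zero_of_ae ?_
    filter_upwards [hw, coeFn_kernelLp hK (Icc_subset_Icc_right hu.2 hs)] with v h1 h2
    rw [h1, h2]
    by_cases hv : v ∈ Ioi u
    · rw [hK.volterra s v (hs.2.trans_lt hv), inner_zero_right]; rfl
    · rw [indicator_of_notMem hv, inner_zero_left]; rfl
  have hmean : ∫ ω, ζ ω ∂P = 0 := by
    refine tendsto_nhds_unique ((continuous_integral_Lp.tendsto ζ).comp hcx)
      (tendsto_const_nhds.congr fun n => ?_)
    rw [Function.comp_apply, hc, linearCombination_single_sub_single_add]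
    have hsum : ∫ ω, (Finsupp.linearCombination ℝ (noiseLp hX) (ψ n)) ω ∂P = 0 := by
      rw [integral_congr_ae (coeFn_linearCombination_noiseLp hX (hψT n))]
      simp only [stepInt, Finsupp.sum]
      rw [integral_finsetSum _ fun r hr =>
        ((hX.memLp (hψT n r hr)).integrable (by norm_num)).const_mul _]
      exact Finset.sum_eq_zero fun r hr => by
        rw [integral_const_mul, hX.centered r (hψT n r hr), mul_zero]
    rw [integral_congr_ae (Lp.coeFn_add _ _), Pi.add_def,
      integral_add (integrable_Lp_two _) (integrable_Lp_two _), hsum,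
      integral_congr_ae (Lp.coeFn_sub _ _), Pi.sub_def,
      integral_sub (integrable_Lp_two _) (integrable_Lp_two _),
      integral_congr_ae (coeFn_noiseLp hX ht), integral_congr_ae (coeFn_noiseLp hX hu),
      hX.centered t ht, hX.centered u hu]
    simp
  have hvar : ‖ζ‖ ^ 2 =
      ∫ ω, X t ω * X t ω ∂P - ∫ v in (0 : ℝ)..u, K t v * K t v ∂m.measure := by
    have hint : IntegrableOn (fun v => K t v * K t v) (Icc 0 T) m.measure :=
      (hK.memLp_section t ht).integrable_mul (hK.memLp_section t ht)
    rw [norm_eq_of_tendsto (inner_noiseLp hX) hck hcx, ← real_inner_self_eq_norm_sq,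
      L2.inner_def, hX.covariance t ht t ht, min_self,
      intervalIntegral_kernel_mul hK le_rfl ht, intervalIntegral.integral_of_le hu.1,
      ← integral_Icc_eq_integral_Ioc, eq_sub_iff_add_eq]
    have hE : (fun v => inner ℝ (w v) (w v)) =ᵐ[m.measure.restrict (Icc 0 T)]
        (Ioi u).indicator fun v => K t v * K t v := by
      filter_upwards [hw] with v hv
      rw [hv]
      by_cases h : v ∈ Ioi u <;> simp [h, -mem_Ioi, sq]
    have e1 : Icc 0 T ∩ Ioi u = Icc 0 T \ Icc 0 u := by
      ext v
      simp only [mem_inter_iff, mem_Ioi, Set.mem_sdiff, mem_Icc, not_and, not_le]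
      exact ⟨fun h => ⟨h.1, fun _ => h.2⟩, fun h => ⟨h.1, h.2 h.1.1⟩⟩
    rw [integral_congr_ae hE, setIntegral_indicator measurableSet_Ioi, e1,
      add_comm]
    have := integral_inter_add_sdiff (measurableSet_Icc (a := (0 : ℝ)) (b := u)) hint
    rwa [inter_eq_right.2 (Icc_subset_Icc_right hu.2)] at this
  refine ⟨A, hAm.measurable, hAI, indepFun_of_mem_chaos hX hu.2 hζmem horth hZ hζZ,
    hvar ▸ sq_nonneg _, ?_⟩
  have hZG := (hasGaussianLaw_of_mem_chaos hX hζmem).congr hζZ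
  rw [hZG.map_eq_gaussianReal, ← integral_congr_ae hζZ, hmean, ← variance_congr hζZ,
    variance_eq_sub (Lp.memLp ζ), hmean, ← hvar, ← real_inner_self_eq_norm_sq, L2.inner_def]
  congr 2
  rw [zero_pow two_ne_zero, sub_zero]
  exact integral_congr_ae (ae_of_all _ fun ω => by simp [sq])

end Noise

/-- The conditioning variable is the identity from `Ω` to `Ω` equipped with `F`, which generates
exactly `F`. -/
lemma condExp_comp_of_indepFun {Ω E : Type*} {F mΩ : MeasurableSpace Ω} [MeasurableSpace E]
    {P : Measure Ω} [IsProbabilityMeasure P] (hF : F ≤ mΩ) {Z : Ω → ℝ}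
    (hZ : Measurable Z) (hind : @IndepFun Ω Ω ℝ mΩ F _ id Z P) {a : Ω → E}
    (ha : Measurable[F] a) {h : E × ℝ → ℝ} (hh : Measurable h)
    (hint : Integrable (fun ω => h (a ω, Z ω)) P) :
    P[fun ω => h (a ω, Z ω) | F] =ᵐ[P] fun ω => ∫ z, h (a ω, z) ∂(P.map Z) := by
  have hm : @Measurable (Ω × ℝ) ℝ (@Prod.instMeasurableSpace Ω ℝ F _) _
      fun p : Ω × ℝ => h (a p.1, p.2) :=
    hh.comp ((ha.comp measurable_fst).prodMk measurable_snd)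
  have := @condExp_of_indepFun Ω Ω mΩ F P _ id Z _ (measurable_id'' hF) hZ.aemeasurable hind
    (@Measurable.stronglyMeasurable _ _ (_) _ _ _ _ _ _ hm) hint
  rwa [MeasurableSpace.comap_id] at this

/-! ### Conditional gains in the pricing model -/

namespace Model

variable {Ω : Type*} [MeasurableSpace Ω] {D : Model Ω}

/-- At a fixed time the price is a deterministic Borel function of the noise, with a Borel inverse
because `S0 > 0`. -/
lemma comap_S (hD : D.Admissible) (t : ℝ) :
    MeasurableSpace.comap (D.S t) inferInstance = MeasurableSpace.comap (D.X t) inferInstance := by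
  set b := D.mu t - D.mu 0 - 1 / 2 * quadVar D.P D.X D.T t with hb
  have h1 : D.S t = (fun x => D.S0 * Real.exp (b + x)) ∘ D.X t := rfl
  have h2 : D.X t = (fun y => Real.log (y / D.S0) - b) ∘ D.S t := by
    funext ω
    simp only [Function.comp_apply, S]
    rw [mul_div_cancel_left₀ _ hD.S0_pos.ne', Real.log_exp]
    ring
  refine le_antisymm ?_ ?_
  · rw [h1, ← MeasurableSpace.comap_comp]
    exact MeasurableSpace.comap_mono (Measurable.comap_le (by fun_prop))
  · conv_lhs => rw [h2, ← MeasurableSpace.comap_comp]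
    exact MeasurableSpace.comap_mono (Measurable.comap_le (by fun_prop))

lemma F_eq_noiseFiltration (hD : D.Admissible) (u : ℝ) : D.F u = noiseFiltration D.X u :=
  iSup_congr fun s => iSup_congr fun _ => comap_S hD s

lemma F_le (hD : D.Admissible) {u : ℝ} (hu : u ≤ D.T) : D.F u ≤ ‹MeasurableSpace Ω› := by
  rw [F_eq_noiseFiltration hD]
  exact noiseFiltration_le hD.noise hu

lemma F_mono (D : Model Ω) {s t : ℝ} (h : s ≤ t) : D.F s ≤ D.F t :=
  iSup₂_le fun r hr => le_iSup₂_of_le r ⟨hr.1, hr.2.trans h⟩ le_rfl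

lemma measurable_S (D : Model Ω) {s u : ℝ} (hs : s ∈ Icc 0 u) : Measurable[D.F u] (D.S s) :=
  measurable_iff_comap_le.2 (le_iSup₂_of_le s hs le_rfl)

lemma measurable_X (hD : D.Admissible) {s u : ℝ} (hs : s ∈ Icc 0 u) :
    Measurable[D.F u] (D.X s) := by
  rw [F_eq_noiseFiltration hD]
  exact measurable_noiseFiltration hs

/-- The asset price is the product of a known factor and of an independent lognormal variable. -/
lemma exists_decomposition (hD : D.Admissible) {u t : ℝ} (hu : u ∈ Icc 0 D.T)
    (ht : t ∈ Icc 0 D.T) :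
    ∃ A Z : Ω → ℝ, Measurable[D.F u] A ∧ A =ᵐ[D.P] wienerInt D.P D.X (D.Psi t u) ∧
      Measurable Z ∧ @IndepFun Ω Ω ℝ _ (D.F u) _ id Z D.P ∧
      D.P.map Z = gaussianReal 0 (D.rhoHat t u ^ 2).toNNReal ∧
      (∀ ω, D.X t ω = D.X u ω - A ω + Z ω) ∧
      ∀ ω, D.S t ω = D.S u ω * Real.exp (D.beta u t - A ω) * Real.exp (Z ω) := by
  have := hD.isProb
  obtain ⟨A, hA, hAI, hind, hnn, hmap⟩ := exists_innovation hD.noise hu ht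
  have hA' : Measurable A := hA.mono (noiseFiltration_le hD.noise hu.2) le_rfl
  have hXe : ∀ ω, D.X t ω = D.X u ω - A ω + (D.X t ω - D.X u ω + A ω) := fun ω => by ring
  rw [F_eq_noiseFiltration hD]
  refine ⟨A, fun ω => D.X t ω - D.X u ω + A ω, hA, hAI,
    ((hD.noise.measurable t ht).sub (hD.noise.measurable u hu)).add hA', hind, ?_, hXe, ?_⟩
  · rw [hmap, rhoHat, Rhat, Real.sq_sqrt hnn]
  · intro ω
    simp only [S, beta, qsq]
    rw [mul_assoc, mul_assoc, ← Real.exp_add, ← Real.exp_add]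
    congr 2
    ring

lemma map_const_mul_gaussianReal (r : ℝ) :
    gaussianReal 0 (r ^ 2).toNNReal = (gaussianReal 0 1).map (r * ·) := by
  rw [gaussianReal_map_const_mul, mul_zero, mul_one]
  congr 1
  exact Real.toNNReal_of_nonneg (sq_nonneg r)

lemma integral_exp_gaussianReal (r : ℝ) :
    ∫ z, Real.exp z ∂(gaussianReal 0 (r ^ 2).toNNReal) = Real.exp (1 / 2 * r ^ 2) := by
  have := mgf_gaussianReal (p := gaussianReal 0 (r ^ 2).toNNReal) (X := id) Measure.map_id 1
  simp only [mgf, id, one_mul, zero_add, one_pow, mul_one,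
    Real.coe_toNNReal _ (sq_nonneg r)] at this
  rw [this]
  ring_nf

lemma integral_sq_gaussianReal (v : NNReal) : ∫ z, z ^ 2 ∂(gaussianReal 0 v) = v := by
  have := variance_id_gaussianReal (μ := 0) (v := v)
  rw [variance_eq_sub (memLp_id_gaussianReal 2)] at this
  simpa using this

lemma integrable_S (hD : D.Admissible) {t : ℝ} (ht : t ∈ Icc 0 D.T) :
    Integrable (D.S t) D.P := by
  have hG := hD.noise.hasGaussianLaw ht
  have h : Integrable (fun x => Real.exp x) (D.P.map (D.X t)) := by
    rw [hG.map_eq_gaussianReal]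
    simpa using integrable_exp_mul_gaussianReal (μ := ∫ ω, D.X t ω ∂D.P)
      (v := Var[D.X t; D.P].toNNReal) 1
  have h2 := (h.comp_aemeasurable hG.aemeasurable).const_mul
    (D.S0 * Real.exp (D.mu t - D.mu 0 - 1 / 2 * quadVar D.P D.X D.T t))
  refine h2.congr (ae_of_all _ fun ω => ?_)
  simp only [S, Function.comp_apply, Real.exp_add, mul_assoc]

section Gains

variable {u t : ℝ} {A Z : Ω → ℝ}

lemma condGain_X (hD : D.Admissible) (hu : u ∈ Icc 0 D.T) (ht : t ∈ Icc 0 D.T)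
    (hA : Measurable[D.F u] A) (hZ : Measurable Z)
    (hind : @IndepFun Ω Ω ℝ _ (D.F u) _ id Z D.P) {v : NNReal}
    (hmap : D.P.map Z = gaussianReal 0 v) (hX : ∀ ω, D.X t ω = D.X u ω - A ω + Z ω) :
    ∀ᵐ ω ∂D.P, D.condGain D.X t u ω = -A ω := by
  have := hD.isProb
  have hXe : D.X t = fun ω => (D.X u ω - A ω) + Z ω := funext hX
  have hint := ((hD.noise.memLp ht).integrable (by norm_num))
  have h := condExp_comp_of_indepFun (F_le hD hu.2) hZ hind
    (a := fun ω => D.X u ω - A ω) (h := fun p => p.1 + p.2)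
    ((measurable_X hD ⟨hu.1, le_rfl⟩).sub hA) (by fun_prop) (by rwa [hXe] at hint)
  filter_upwards [h] with ω hω
  have hi : Integrable (fun z : ℝ => z) (gaussianReal 0 v) :=
    (memLp_id_gaussianReal 1).integrable le_rfl
  have hid : ∫ z, z ∂(gaussianReal 0 v) = 0 := integral_id_gaussianReal
  rw [condGain, hXe, hω, hmap, integral_add (integrable_const _) hi, integral_const, hid]
  simp

/-- Removing the conditional mean `-A` from the increment leaves exactly `Z`, whose square is
independent of the past. -/
lemma condVar_X (hD : D.Admissible) (hu : u ∈ Icc 0 D.T) (ht : t ∈ Icc 0 D.T)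
    (hA : Measurable[D.F u] A) (hZ : Measurable Z)
    (hind : @IndepFun Ω Ω ℝ _ (D.F u) _ id Z D.P) {v : NNReal}
    (hmap : D.P.map Z = gaussianReal 0 v) (hX : ∀ ω, D.X t ω = D.X u ω - A ω + Z ω) :
    ∀ᵐ ω ∂D.P, (Var[fun ω => D.X t ω - D.X u ω; D.P | D.F u]) ω = v := by
  have := hD.isProb
  have hF := F_le hD hu.2
  have hit := (hD.noise.memLp ht).integrable (by norm_num)
  have hiu := (hD.noise.memLp hu).integrable (by norm_num)
  have hsub : D.P[fun ω => D.X t ω - D.X u ω | D.F u] =ᵐ[D.P] fun ω => -A ω := by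
    filter_upwards [condExp_sub hit hiu (D.F u), condGain_X hD hu ht hA hZ hind hmap hX]
      with ω h1 h2
    rw [condExp_of_stronglyMeasurable hF (measurable_X hD ⟨hu.1, le_rfl⟩).stronglyMeasurable
      hiu] at h1
    exact h1.trans h2
  have hsq : ((fun ω => D.X t ω - D.X u ω) - D.P[fun ω => D.X t ω - D.X u ω | D.F u]) ^ 2
      =ᵐ[D.P] fun ω => Z ω ^ 2 := by
    filter_upwards [hsub] with ω h
    rw [Pi.pow_apply, Pi.sub_apply, h, hX ω]
    ring
  have hZ2 : Integrable (fun ω => Z ω ^ 2) D.P := by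
    have h := (memLp_id_gaussianReal (μ := 0) (v := v) 2).integrable_sq
    rw [← hmap] at h
    exact h.comp_measurable hZ
  have h := condExp_comp_of_indepFun hF hZ hind (a := A) (h := fun p => p.2 ^ 2) hA
    (by fun_prop) hZ2
  filter_upwards [condExp_congr_ae (m := D.F u) hsq, h] with ω h1 h2
  rw [condVar, h1, h2, hmap, integral_sq_gaussianReal]

/-- Conditional expectation of an affine function of the asset price with known coefficients. -/
lemma condExp_add_mul_S (hD : D.Admissible) (hu : u ∈ Icc 0 D.T)
    (hA : Measurable[D.F u] A) (hZ : Measurable Z)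
    (hind : @IndepFun Ω Ω ℝ _ (D.F u) _ id Z D.P)
    (hmap : D.P.map Z = gaussianReal 0 (D.rhoHat t u ^ 2).toNNReal)
    (hS : ∀ ω, D.S t ω = D.S u ω * Real.exp (D.beta u t - A ω) * Real.exp (Z ω))
    {b c : Ω → ℝ} (hb : Measurable[D.F u] b) (hc : Measurable[D.F u] c)
    (hint : Integrable (fun ω => b ω + c ω * D.S t ω) D.P) :
    ∀ᵐ ω ∂D.P, (D.P[fun ω => b ω + c ω * D.S t ω | D.F u]) ω =
      b ω + c ω * (D.S u ω * Real.exp (D.beta u t + 1 / 2 * D.rhoHat t u ^ 2 - A ω)) := by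
  have := hD.isProb
  have hE : (fun ω => b ω + c ω * D.S t ω) = fun ω =>
      b ω + c ω * (D.S u ω * Real.exp (D.beta u t - A ω)) * Real.exp (Z ω) := by
    funext ω
    rw [hS ω]
    ring
  have hm : Measurable[D.F u] fun ω =>
      (b ω, c ω * (D.S u ω * Real.exp (D.beta u t - A ω))) :=
    hb.prodMk (hc.mul ((measurable_S D ⟨hu.1, le_rfl⟩).mul
      (Real.measurable_exp.comp (measurable_const.sub hA))))
  have h := condExp_comp_of_indepFun (F_le hD hu.2) hZ hind
    (h := fun p => p.1.1 + p.1.2 * Real.exp p.2) hm (by fun_prop) (by rwa [hE] at hint)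
  filter_upwards [h] with ω hω
  have hi : Integrable (fun z : ℝ => Real.exp z)
      (gaussianReal 0 (D.rhoHat t u ^ 2).toNNReal) := by
    simpa using integrable_exp_mul_gaussianReal (μ := 0) (v := (D.rhoHat t u ^ 2).toNNReal) 1
  rw [hE, hω, hmap, integral_add (integrable_const _) (hi.const_mul _), integral_const,
    integral_const_mul, integral_exp_gaussianReal, probReal_univ, one_smul, mul_assoc, mul_assoc,
    ← Real.exp_add]
  ring_nf

lemma condGain_Vpi (hD : D.Admissible) (hu : u ∈ Icc 0 D.T) (hA : Measurable[D.F u] A)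
    (hZ : Measurable Z) (hind : @IndepFun Ω Ω ℝ _ (D.F u) _ id Z D.P)
    (hmap : D.P.map Z = gaussianReal 0 (D.rhoHat t u ^ 2).toNNReal)
    (hS : ∀ ω, D.S t ω = D.S u ω * Real.exp (D.beta u t - A ω) * Real.exp (Z ω))
    {f : ℝ → ℝ} (hf : Measurable f)
    (hfu : ∀ᵐ ω ∂D.P, Integrable (fun z => f (D.S u ω *
      Real.exp (-(1 / 2) * D.qsq u D.T + D.q u D.T * z))) (gaussianReal 0 1))
    (hft : Integrable (fun p : Ω × ℝ => f (D.S t p.1 *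
      Real.exp (-(1 / 2) * D.qsq t D.T + D.q t D.T * p.2))) (D.P.prod (gaussianReal 0 1))) :
    ∀ᵐ ω ∂D.P,
      Integrable (fun p : ℝ × ℝ => f (D.S u ω * Real.exp (D.gam u t - A ω
        + D.rhoHat t u * p.1 + D.q t D.T * p.2))) ((gaussianReal 0 1).prod (gaussianReal 0 1)) ∧
      D.condGain (D.Vpi f) t u ω =
        ∫ z, ((∫ y, f (D.S u ω * Real.exp (D.gam u t - A ω
            + D.rhoHat t u * y + D.q t D.T * z)) ∂(gaussianReal 0 1))
          - f (D.S u ω * Real.exp (-(1 / 2) * D.qsq u D.T + D.q u D.T * z)))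
          ∂(gaussianReal 0 1) := by
  have := hD.isProb
  set g := gaussianReal 0 1
  set ρ := D.rhoHat t u
  set a : Ω → ℝ := fun ω => D.S u ω * Real.exp (D.beta u t - A ω) with ha
  have ham : Measurable[D.F u] a := (measurable_S D ⟨hu.1, le_rfl⟩).mul
      (Real.measurable_exp.comp (measurable_const.sub hA))
  have ham' : Measurable a := ham.mono (F_le hD hu.2) le_rfl
  have hNg : D.P.map Z = g.map (ρ * ·) := hmap.trans (map_const_mul_gaussianReal ρ)
  set H : (ℝ × ℝ) × ℝ → ℝ := fun p => f (p.1.1 * Real.exp p.1.2 *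
    Real.exp (-(1 / 2) * D.qsq t D.T + D.q t D.T * p.2)) with hH
  have hHm : Measurable H := by fun_prop
  have hHe (ω : Ω) (y z : ℝ) : H ((a ω, ρ * y), z) =
      f (D.S u ω * Real.exp (D.gam u t - A ω + ρ * y + D.q t D.T * z)) := by
    simp only [hH, ha, gam]
    rw [mul_assoc, mul_assoc, ← Real.exp_add, ← Real.exp_add]
    congr 3
    ring
  have haZ : IndepFun a Z D.P := by
    rw [IndepFun_iff_Indep]
    have h := (@IndepFun_iff_Indep Ω Ω ℝ _ (D.F u) _ id Z D.P).1 hind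
    rw [MeasurableSpace.comap_id] at h
    exact indep_of_indep_of_le_left h ham.comap_le
  -- Independence turns the integrability of the payoff under `P ⊗ φ(z)dz` into integrability under
  -- a product of three laws, so that almost every section in the known variable is integrable in
  -- the other two.
  have hHint : Integrable H (((D.P.map a).prod (D.P.map Z)).prod g) := by
    rw [← (indepFun_iff_map_prod_eq_prod_map_map ham'.aemeasurable hZ.aemeasurable).1 haZ]
    have e : (D.P.map fun ω => (a ω, Z ω)).prod g =
        (D.P.prod g).map (Prod.map (fun ω => (a ω, Z ω)) id) := by
      rw [← Measure.map_prod_map _ _ (ham'.prodMk hZ) measurable_id, Measure.map_id]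
    rw [e, integrable_map_measure hHm.aestronglyMeasurable
      ((ham'.prodMk hZ).prodMap measurable_id).aemeasurable]
    refine hft.congr (ae_of_all _ fun p => ?_)
    simp only [hS]
    rfl
  have : IsProbabilityMeasure (D.P.map a) := Measure.isProbabilityMeasure_map ham'.aemeasurable
  have : IsProbabilityMeasure (D.P.map Z) := Measure.isProbabilityMeasure_map hZ.aemeasurable
  have hint2 : ∀ᵐ ω ∂D.P, Integrable (fun p : ℝ × ℝ => H ((a ω, ρ * p.1), p.2)) (g.prod g) := by
    have h1 : Integrable (fun p : ℝ × ℝ × ℝ => H ((p.1, p.2.1), p.2.2))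
        ((D.P.map a).prod ((D.P.map Z).prod g)) := by
      have hmp := (measurePreserving_prodAssoc (D.P.map a) (D.P.map Z) g).symm
      exact hmp.integrable_comp_of_integrable hHint
    filter_upwards [ae_of_ae_map ham'.aemeasurable h1.prod_right_ae] with ω hω
    have e : (D.P.map Z).prod g = (g.prod g).map (Prod.map (ρ * ·) id) := by
      rw [hNg, ← Measure.map_prod_map _ _ (measurable_const_mul ρ) measurable_id, Measure.map_id]
    rw [e] at hω
    exact hω.comp_measurable ((measurable_const_mul ρ).prodMap measurable_id)
  have hvm : Measurable fun x => D.value f t x := by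
    refine StronglyMeasurable.measurable (StronglyMeasurable.integral_prod_right
      (f := fun x z => f (x * Real.exp (-(1 / 2) * D.qsq t D.T + D.q t D.T * z))) ?_)
    exact Measurable.stronglyMeasurable (by fun_prop)
  have hV : Integrable (D.Vpi f t) D.P := hft.integral_prod_left
  have hVe : D.Vpi f t = fun ω => D.value f t (a ω * Real.exp (Z ω)) := by
    funext ω
    rw [Vpi, hS]
  have hce := condExp_comp_of_indepFun (F_le hD hu.2) hZ hind
    (h := fun p => D.value f t (p.1 * Real.exp p.2)) ham
    (hvm.comp (by fun_prop)) (by rwa [hVe] at hV)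
  filter_upwards [hce, hint2, hfu] with ω h1 h2 h3
  refine ⟨h2.congr (ae_of_all _ fun p => hHe ω p.1 p.2), ?_⟩
  have hm : Measurable fun z => D.value f t (a ω * Real.exp z) :=
    hvm.comp (f := fun z => a ω * Real.exp z) (by fun_prop)
  -- Freezing leaves the innovation variable `y` outermost; Fubini's theorem moves it inside.
  have h4 : ∫ z, D.value f t (a ω * Real.exp z) ∂(D.P.map Z) =
      ∫ z, ∫ y, H ((a ω, ρ * y), z) ∂g ∂g := by
    rw [hNg, integral_map (measurable_const_mul ρ).aemeasurable hm.aestronglyMeasurable]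
    exact integral_integral_swap (f := fun y z => H ((a ω, ρ * y), z)) h2
  rw [condGain, hVe, h1, h4, integral_sub]
  · simp_rw [hHe]
    rfl
  · simpa only [hHe] using h2.integral_prod_right
  · exact h3

end Gains

/-! ### Discrete trading with transaction costs -/

section Discrete

variable {N : ℕ} {t : ℕ → ℝ} {pos : ℕ → Ω → ℝ}

lemma lt_of_lt_of_le (ht : ∀ j < N, t j < t (j + 1)) {j n : ℕ} (hjn : j < n) (hn : n ≤ N) :
    t j < t n := by
  induction n, hjn using Nat.le_induction with
  | base => exact ht j hn
  | succ n _ ih => exact (ih (Nat.le_of_succ_le hn)).trans (ht n hn)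

lemma le_of_le_of_le (ht : ∀ j < N, t j < t (j + 1)) {j n : ℕ} (hjn : j ≤ n) (hn : n ≤ N) :
    t j ≤ t n := by
  rcases hjn.eq_or_lt with rfl | h
  · exact le_rfl
  · exact (lt_of_lt_of_le ht h hn).le

/-- For `j ≥ n` both price times are truncated to `t n` and the gain is zero. The strict inequality
in the cost sum leaves out the trade made at `t n` itself. -/
lemma Vdisc_trading_time (D : Model Ω) (k V0 : ℝ) (ht : ∀ j < N, t j < t (j + 1)) {n : ℕ}
    (hn : n ≤ N) (ω : Ω) :
    D.Vdisc k N t V0 pos (t n) ω =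
      V0 + ∑ j ∈ Finset.range n, pos j ω * (D.S (t (j + 1)) ω - D.S (t j) ω)
        - ∑ j ∈ Finset.range n, k * D.S (t j) ω * |jump pos j ω| := by
  have hfilter : (Finset.range N).filter (fun j => t j < t n) = Finset.range n := by
    ext j
    simp only [Finset.mem_filter, Finset.mem_range]
    refine ⟨fun h => ?_, fun h => ⟨h.trans_le hn, lt_of_lt_of_le ht h hn⟩⟩
    by_contra hj
    exact h.2.not_ge (le_of_le_of_le ht (not_lt.1 hj) h.1.le)
  rw [Vdisc, hfilter]
  congr 2
  rw [← Finset.sum_subset (Finset.range_subset_range.2 hn) fun j hj hjn => ?_]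
  · refine Finset.sum_congr rfl fun j hj => ?_
    have hjn := Finset.mem_range.1 hj
    rw [min_eq_right (le_of_le_of_le ht hjn hn), min_eq_right (le_of_le_of_le ht hjn.le hn)]
  · have hjN := Finset.mem_range.1 hj
    have hnj : n ≤ j := not_lt.1 fun h => hjn (Finset.mem_range.2 h)
    rw [min_eq_left (le_of_le_of_le ht hnj hjN.le),
      min_eq_left (le_of_le_of_le ht (hnj.trans (Nat.le_succ j)) hjN), sub_self, mul_zero]

lemma measurable_jump (ht : ∀ j < N, t j < t (j + 1))
    (hpos : ∀ j < N, Measurable[D.F (t j)] (pos j)) {j : ℕ} (hj : j < N) :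
    Measurable[D.F (t j)] (jump pos j) := by
  cases j with
  | zero => exact hpos 0 hj
  | succ j =>
    have hj' : j < N := (Nat.lt_succ_self j).trans hj
    exact (hpos _ hj).sub ((hpos j hj').mono (F_mono D (ht j hj').le) le_rfl)

lemma measurable_Vdisc (ht0 : t 0 = 0) (ht : ∀ j < N, t j < t (j + 1))
    (hpos : ∀ j < N, Measurable[D.F (t j)] (pos j)) (k V0 : ℝ) {n : ℕ} (hn : n ≤ N) :
    Measurable[D.F (t n)] (D.Vdisc k N t V0 pos (t n)) := by
  have hS : ∀ j ≤ n, Measurable[D.F (t n)] (D.S (t j)) := fun j hj => measurable_S D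
    ⟨ht0 ▸ le_of_le_of_le ht (Nat.zero_le j) (hj.trans hn), le_of_le_of_le ht hj hn⟩
  have hmono : ∀ j < n, D.F (t j) ≤ D.F (t n) := fun j hj =>
    F_mono D (lt_of_lt_of_le ht hj hn).le
  rw [funext (Vdisc_trading_time D k V0 ht hn)]
  refine (measurable_const.add (Finset.measurable_sum _ fun j hj => ?_)).sub
    (Finset.measurable_sum _ fun j hj => ?_)
  · have hj := Finset.mem_range.1 hj
    exact ((hpos j (hj.trans_le hn)).mono (hmono j hj) le_rfl).mul
      ((hS _ hj).sub (hS _ hj.le))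
  · have hj := Finset.mem_range.1 hj
    exact ((hS j hj.le).const_mul k).mul
      (measurable_abs.comp ((measurable_jump ht hpos (hj.trans_le hn)).mono (hmono j hj) le_rfl))

end Discrete

end Model

end GaussVolterra

theorem lemma5p1 {Ω : Type*} [MeasurableSpace Ω] (D : Model Ω) (hD : D.Admissible)
    -- the payoff
    (f : ℝ → ℝ) (hf : Measurable f)
    -- the trading times, the transaction costs and the discrete strategy
    (N : ℕ) (t : ℕ → ℝ) (ht0 : t 0 = 0) (ht : ∀ j < N, t j < t (j + 1)) (htN : t N < D.T)
    (k : ℝ) (hk : k ∈ Ico (0 : ℝ) 1) (V0 : ℝ) (pos : ℕ → Ω → ℝ)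
    (hpos : ∀ j < N, Measurable[D.F (t j)] (pos j))
    (i : ℕ) (hi : i < N) :
    -- the gain of the noise
    (Integrable (D.X (t (i + 1))) D.P ∧
      ∀ᵐ ω ∂D.P, D.condGain D.X (t (i + 1)) (t i) ω =
        -wienerInt D.P D.X (D.Psi (t (i + 1)) (t i)) ω) ∧
    -- the conditional variance is the number `ρ̂²`
    (∀ᵐ ω ∂D.P, (Var[fun ω => D.X (t (i + 1)) ω - D.X (t i) ω; D.P | D.F (t i)]) ω =
        D.rhoHat (t (i + 1)) (t i) ^ 2) ∧
    -- the gain of the asset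
    (Integrable (D.S (t (i + 1))) D.P ∧
      ∀ᵐ ω ∂D.P, D.condGain D.S (t (i + 1)) (t i) ω =
        D.S (t i) ω * (Real.exp (D.beta (t i) (t (i + 1))
          + 1 / 2 * D.rhoHat (t (i + 1)) (t i) ^ 2
          + D.condGain D.X (t (i + 1)) (t i) ω) - 1)) ∧
    -- the gain of the frictionless value, when the option values are integrable
    ((∀ᵐ ω ∂D.P, Integrable (fun z => f (D.S (t i) ω *
          Real.exp (-(1 / 2) * D.qsq (t i) D.T + D.q (t i) D.T * z))) (gaussianReal 0 1)) →
      Integrable (fun p : Ω × ℝ => f (D.S (t (i + 1)) p.1 *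
          Real.exp (-(1 / 2) * D.qsq (t (i + 1)) D.T + D.q (t (i + 1)) D.T * p.2)))
        (D.P.prod (gaussianReal 0 1)) →
      Integrable (D.Vpi f (t (i + 1))) D.P ∧
      ∀ᵐ ω ∂D.P,
        Integrable (fun p : ℝ × ℝ => f (D.S (t i) ω * Real.exp (D.gam (t i) (t (i + 1))
            + D.condGain D.X (t (i + 1)) (t i) ω
            + D.rhoHat (t (i + 1)) (t i) * p.1 + D.q (t (i + 1)) D.T * p.2)))
          ((gaussianReal 0 1).prod (gaussianReal 0 1)) ∧
        D.condGain (D.Vpi f) (t (i + 1)) (t i) ω =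
          ∫ z, ((∫ y, f (D.S (t i) ω * Real.exp (D.gam (t i) (t (i + 1))
              + D.condGain D.X (t (i + 1)) (t i) ω
              + D.rhoHat (t (i + 1)) (t i) * y + D.q (t (i + 1)) D.T * z)) ∂(gaussianReal 0 1))
            - f (D.S (t i) ω *
                Real.exp (-(1 / 2) * D.qsq (t i) D.T + D.q (t i) D.T * z))) ∂(gaussianReal 0 1)) ∧
    -- the gain of the discrete strategy, when its value is integrable
    (Integrable (D.Vdisc k N t V0 pos (t (i + 1))) D.P →
      ∀ᵐ ω ∂D.P, D.condGain (D.Vdisc k N t V0 pos) (t (i + 1)) (t i) ω =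
        pos i ω * D.condGain D.S (t (i + 1)) (t i) ω
          - k * D.S (t i) ω * |Model.jump pos i ω|) := by
  have := hD.isProb
  have hmem : ∀ n ≤ N, t n ∈ Icc 0 D.T := fun n hn =>
    ⟨ht0 ▸ Model.le_of_le_of_le ht (Nat.zero_le n) hn,
      (Model.le_of_le_of_le ht hn le_rfl).trans htN.le⟩
  have hu := hmem i hi.le
  have hs := hmem (i + 1) hi
  obtain ⟨A, Z, hA, hAI, hZ, hind, hmap, hX, hS⟩ := Model.exists_decomposition hD hu hs
  have hgX := Model.condGain_X hD hu hs hA hZ hind hmap hX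
  have hiS := Model.integrable_S hD hs
  have hgS : ∀ᵐ ω ∂D.P, D.condGain D.S (t (i + 1)) (t i) ω =
      D.S (t i) ω * (Real.exp (D.beta (t i) (t (i + 1))
        + 1 / 2 * D.rhoHat (t (i + 1)) (t i) ^ 2
        + D.condGain D.X (t (i + 1)) (t i) ω) - 1) := by
    have h := Model.condExp_add_mul_S hD hu hA hZ hind hmap hS (b := fun _ => 0)
      (c := fun _ => 1) measurable_const measurable_const (by simpa using hiS)
    simp only [zero_add, one_mul] at h
    filter_upwards [h, hgX] with ω h1 h2
    rw [h2, Model.condGain, h1]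
    ring_nf
  refine ⟨⟨(hD.noise.memLp hs).integrable (by norm_num), ?_⟩, ?_, ⟨hiS, hgS⟩,
    fun hfu hft => ⟨hft.integral_prod_left, ?_⟩, fun hV => ?_⟩
  · filter_upwards [hgX, hAI] with ω h1 h2
    rw [h1, h2]
  · filter_upwards [Model.condVar_X hD hu hs hA hZ hind hmap hX] with ω h
    rw [h, Real.coe_toNNReal _ (sq_nonneg _)]
  · filter_upwards [Model.condGain_Vpi hD hu hA hZ hind hmap hS hf hfu hft, hgX] with ω h1 h2
    rw [h2]
    simpa only [sub_eq_add_neg] using h1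
  -- Between `t i` and `t (i + 1)` only `pos i` is held, and the cost of the trade at `t i` is
  -- charged, so the new value is affine in the new price with coefficients known at `t i`.
  -- Conditioning the whole sum avoids requiring `b` and `pos i * S` to be separately integrable.
  · set b : Ω → ℝ := fun ω => D.Vdisc k N t V0 pos (t i) ω - pos i ω * D.S (t i) ω
      - k * D.S (t i) ω * |Model.jump pos i ω| with hb
    have hVe : D.Vdisc k N t V0 pos (t (i + 1)) = fun ω => b ω + pos i ω * D.S (t (i + 1)) ω := by
      funext ω
      simp only [hb]
      rw [Model.Vdisc_trading_time D k V0 ht hi, Model.Vdisc_trading_time D k V0 ht hi.le,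
        Finset.sum_range_succ, Finset.sum_range_succ]
      ring
    have hSm := D.measurable_S (s := t i) (u := t i) ⟨hu.1, le_rfl⟩
    have hbm : Measurable[D.F (t i)] b :=
      ((Model.measurable_Vdisc ht0 ht hpos k V0 hi.le).sub ((hpos i hi).mul hSm)).sub
        ((hSm.const_mul k).mul (measurable_abs.comp (Model.measurable_jump ht hpos hi)))
    have h := Model.condExp_add_mul_S hD hu hA hZ hind hmap hS hbm (hpos i hi)
      (by rwa [hVe] at hV)
    filter_upwards [h, hgS, hgX] with ω h1 h2 h3
    rw [h2, h3, Model.condGain, hVe, h1, hb]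
    ring_nf
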